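/- Let $\pi:Y\to X$ be a smooth fibre bundle over an $n$-dimensional manifold $X$, $n\ge 1$ ($X$, $Y$ real, finite-dimensional, Hausdorff, second-countable and connected), with fibred coordinates $(x^\lambda,y^i)$, $\omega=dx^1\wedge\cdots\wedge dx^n$, $\omega_\lambda=\partial_\lambda\rfloor\omega$. Let $J^1Y$ be its first jet manifold with coordinates $(x^\lambda,y^i,y^i_\lambda)$, $\Pi=\bigwedge^nT^*X\otimes_YV^*Y\otimes_YTX$ the Legendre bundle with coordinates $(x^\lambda,y^i,p^\lambda_i)$, and $Z_Y=T^*Y\wedge(\bigwedge^{n-1}T^*X)\subset\bigwedge^nT^*Y$ the homogeneous Legendre bundle with coordinates $(x^\lambda,y^i,p^\lambda_i,p)$, equipped with the canonical form $\Xi_Y=p\,\omega+p^\lambda_i\,dy^i\wedge\omega_\lambda$. Let $L=\mathcal L\,\omega:J^1Y\to\bigwedge^nT^*X$ be a smooth Lagrangian and $\pi^\lambda_i=\partial\mathcal L/\partial y^i_\lambda$. Let $\widehat L:J^1Y\to\Pi$, $p^\lambda_i\circ\widehat L=\pi^\lambda_i$, be its Legendre map, $H_L=L+\pi^\lambda_i(dy^i-y^i_\mu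 dx^\mu)\wedge\omega_\lambda$ its Poincaré–Cartan form, and $\widehat H_L:J^1Y\to Z_Y$, $(p^\mu_i,p)\circ\widehat H_L=(\pi^\mu_i,\mathcal L-\pi^\mu_iy^i_\mu)$, the associated Legendre morphism. Put $N_L=\widehat L(J^1Y)\subset\Pi$ and $Z_L=\widehat H_L(J^1Y)\subset Z_Y$. Assume that * $L$ is almost regular: $N_L$ is a closed imbedded subbundle of $\Pi\to Y$, and $\widehat L:J^1Y\to N_L$ is a fibred manifold (a surjective submersion) with connected fibres; * $\widehat L:J^1Y\to N_L$ has a global section; * $Z_L$ is an imbedded submanifold $i_L:Z_L\hookrightarrow Z_Y$. For a global section $\Psi$ of $\widehat L:J^1Y\to N_L$, let $H_N=\Psi^*H_L$ be the constrained Hamiltonian form on $N_L$, and let $\Xi_L=i_L^*\Xi_Y$ be the De Donder form on $Z_L$. The constrained Hamilton equations for a section $r$ of $N_L\to X$ are $$r^*(u_N\rfloor dH_N)=0\quad\text{for all vertical vector fields } u_N \text{ on } N_L\to X,$$ and the Hamilton–De Donder equations for a section $\overline r$ of $Z_L\to X$ are $$\overline r^*(u\rfloor d\Xi_L)=0\quad\text{for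 all vertical vector fields } u \text{ on } Z_L\to X.$$ Then the constrained Hamilton equations are equivalent to the Hamilton–De Donder equations, in the following sense. There is a diffeomorphism $\varphi:N_L\to Z_L$ over $Y$ such that, for every global section $\Psi$ of $\widehat L:J^1Y\to N_L$, one has $\varphi=\widehat H_L\circ\Psi$ (so that $\widehat H_L\circ\Psi$ is independent of $\Psi$) and $H_N=\varphi^*\Xi_L$, and for every open $U\subseteq X$ (in particular for $U=X$): 1. a section $r$ of $N_L\to X$ over $U$ satisfies the constrained Hamilton equations on $U$ if and only if the section $\varphi\circ r$ of $Z_L\to X$ satisfies the Hamilton–De Donder equations on $U$; 2. a section $\overline r$ of $Z_L\to X$ over $U$ satisfies the Hamilton–De Donder equations on $U$ if and only if the section $\varphi^{-1}\circ\overline r$ of $N_L\to X$ satisfies the constrained Hamilton equations on $U$. -/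

import Mathlib

set_option maxSynthPendingDepth 3

open scoped Manifold ContDiff Topology
open Set Module

noncomputable section

/-! ### Differential forms on manifolds

For a manifold `M` modelled on `E`, Mathlib's tangent space `TangentSpace 𝓘(ℝ, E) m` is, by
definition, the model space `E` (a tangent vector is recorded by its components in the preferred
chart at `m`).  Below we write `E` for it whenever a norm on it is convenient. -/

section Forms

variable {E M E' M' : Type*}
  [NormedAddCommGroup E] [NormedSpace ℝ E] [TopologicalSpace M] [ChartedSpace E M]
  [NormedAddCommGroup E'] [NormedSpace ℝ E'] [TopologicalSpace M'] [ChartedSpace E' M']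

/-- Exterior `k`-forms on a manifold `M` modelled on `E`: `α m` is an alternating form on
`T_m M`. -/
abbrev DiffForm (E M : Type*) [NormedAddCommGroup E] [NormedSpace ℝ E] (k : ℕ) :=
  M → E [⋀^Fin k]→L[ℝ] ℝ

/-- The tangent map `T_m M → T_{f m} M'` of `f`. -/
def tangentMapAt (E E' : Type*) {M M' : Type*}
    [NormedAddCommGroup E] [NormedSpace ℝ E] [TopologicalSpace M] [ChartedSpace E M]
    [NormedAddCommGroup E'] [NormedSpace ℝ E'] [TopologicalSpace M'] [ChartedSpace E' M']
    (f : M → M') (m : M) : E →L[ℝ] E' :=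
  mfderiv 𝓘(ℝ, E) 𝓘(ℝ, E') f m

/-- The pull-back `f^* α` of an exterior form. -/
def DiffForm.pullback {k : ℕ} (f : M → M') (α : DiffForm E' M' k) : DiffForm E M k :=
  fun m => (α (f m)).compContinuousLinearMap (tangentMapAt E E' f m)

/-- The exterior derivative of a form on a manifold: at `m` it is the exterior derivative, in the
model space, of the expression of the form in the preferred chart at `m`. -/
def DiffForm.d {k : ℕ} (α : DiffForm E M k) : DiffForm E M (k + 1) :=
  fun m => extDeriv (DiffForm.pullback (M := E) (chartAt E m).symm α) (chartAt E m m)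

/-- `p : M → B` is a smooth locally trivial fibre bundle with typical fibre `F`. -/
structure IsSmoothFibreBundle (EB EE EF : Type*) {B M : Type*} (F : Type*)
    [NormedAddCommGroup EB] [NormedSpace ℝ EB] [TopologicalSpace B] [ChartedSpace EB B]
    [NormedAddCommGroup EE] [NormedSpace ℝ EE] [TopologicalSpace M] [ChartedSpace EE M]
    [NormedAddCommGroup EF] [NormedSpace ℝ EF] [TopologicalSpace F] [ChartedSpace EF F]
    (p : M → B) : Prop where
  contMDiff : ContMDiff 𝓘(ℝ, EE) 𝓘(ℝ, EB) ∞ p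
  surjective : Function.Surjective p
  exists_trivialization : ∀ b : B, ∃ U : Set B, IsOpen U ∧ b ∈ U ∧
    ∃ Φ : OpenPartialHomeomorph M (B × F),
      Φ.source = p ⁻¹' U ∧ Φ.target = U ×ˢ univ ∧ (∀ m ∈ Φ.source, (Φ m).1 = p m) ∧
      ContMDiffOn 𝓘(ℝ, EE) (𝓘(ℝ, EB).prod 𝓘(ℝ, EF)) ∞ Φ Φ.source ∧
      ContMDiffOn (𝓘(ℝ, EB).prod 𝓘(ℝ, EF)) 𝓘(ℝ, EE) ∞ Φ.symm Φ.target

end Forms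

/-- The model space of an `(n+1)`-dimensional base manifold. -/
abbrev BaseModel (n : ℕ) := EuclideanSpace ℝ (Fin (n + 1))

/-- A smooth fibre bundle `Y → X` with typical fibre `F`, over a base with `dim X = n + 1`. -/
structure FibreBundle (n : ℕ) (EY EF X Y F : Type*)
    [NormedAddCommGroup EY] [NormedSpace ℝ EY] [NormedAddCommGroup EF] [NormedSpace ℝ EF]
    [TopologicalSpace X] [ChartedSpace (BaseModel n) X]
    [TopologicalSpace Y] [ChartedSpace EY Y]
    [TopologicalSpace F] [ChartedSpace EF F] where
  proj : Y → X
  isSmoothFibreBundle : IsSmoothFibreBundle (BaseModel n) EY EF F proj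

namespace FibreBundle

variable {n : ℕ} {EY EF X Y F : Type*}
  [NormedAddCommGroup EY] [NormedSpace ℝ EY] [NormedAddCommGroup EF] [NormedSpace ℝ EF]
  [TopologicalSpace X] [ChartedSpace (BaseModel n) X]
  [TopologicalSpace Y] [ChartedSpace EY Y]
  [TopologicalSpace F] [ChartedSpace EF F]

/-- Fibred coordinates `(x^λ, y^i)` on `Y`: a chart `total` of `Y` with values in `EX × EF`
and a chart `base` of `X` in which `Y → X` is the first projection. -/
structure AdaptedChart (B : FibreBundle n EY EF X Y F) where
  base : OpenPartialHomeomorph X (BaseModel n)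
  contMDiffOn_base : ContMDiffOn 𝓘(ℝ, BaseModel n) 𝓘(ℝ, BaseModel n) ∞ base base.source
  contMDiffOn_base_symm :
    ContMDiffOn 𝓘(ℝ, BaseModel n) 𝓘(ℝ, BaseModel n) ∞ base.symm base.target
  total : OpenPartialHomeomorph Y (BaseModel n × EF)
  contMDiffOn_total : ContMDiffOn 𝓘(ℝ, EY) 𝓘(ℝ, BaseModel n × EF) ∞ total total.source
  contMDiffOn_total_symm :
    ContMDiffOn 𝓘(ℝ, BaseModel n × EF) 𝓘(ℝ, EY) ∞ total.symm total.target
  proj_mem : ∀ y ∈ total.source, B.proj y ∈ base.source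
  fst_total : ∀ y ∈ total.source, (total y).1 = base (B.proj y)

/-- Fibred coordinates exist around every point. -/
theorem exists_adaptedChart [IsManifold 𝓘(ℝ, BaseModel n) ∞ X] [IsManifold 𝓘(ℝ, EF) ∞ F]
    (B : FibreBundle n EY EF X Y F) (y : Y) : ∃ A : B.AdaptedChart, y ∈ A.total.source := by
  obtain ⟨U, hU, hy, Φ, hs, ht, hp, h1, h2⟩ :=
    B.isSmoothFibreBundle.exists_trivialization (B.proj y)
  have hyΦ : y ∈ Φ.source := by rw [hs]; exact hy
  set c := chartAt (BaseModel n) (B.proj y) with hc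
  set f := chartAt EF (Φ y).2 with hf
  have hc1 : ContMDiffOn 𝓘(ℝ, BaseModel n) 𝓘(ℝ, BaseModel n) ∞ c c.source := contMDiffOn_chart
  have hc2 : ContMDiffOn 𝓘(ℝ, BaseModel n) 𝓘(ℝ, BaseModel n) ∞ c.symm c.target :=
    contMDiffOn_chart_symm
  have hf1 : ContMDiffOn 𝓘(ℝ, EF) 𝓘(ℝ, EF) ∞ f f.source := contMDiffOn_chart
  have hf2 : ContMDiffOn 𝓘(ℝ, EF) 𝓘(ℝ, EF) ∞ f.symm f.target := contMDiffOn_chart_symm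
  have hmem : ∀ z ∈ (Φ.trans (c.prod f)).source,
      z ∈ Φ.source ∧ (Φ z).1 ∈ c.source ∧ (Φ z).2 ∈ f.source := by
    intro z hz
    simpa [OpenPartialHomeomorph.trans_source] using hz
  refine ⟨⟨c, hc1, hc2, Φ.trans (c.prod f), ?_, ?_, ?_, ?_⟩, ?_⟩
  · rw [modelWithCornersSelf_prod, ← chartedSpaceSelf_prod]
    have h3 : ContMDiffOn (𝓘(ℝ, BaseModel n).prod 𝓘(ℝ, EF)) (𝓘(ℝ, BaseModel n).prod 𝓘(ℝ, EF)) ∞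
        (Prod.map c f) (c.source ×ˢ f.source) := hc1.prodMap hf1
    have := h3.comp (h1.mono fun z hz => (hmem z hz).1) (fun z hz => (hmem z hz).2)
    exact this
  · rw [modelWithCornersSelf_prod, ← chartedSpaceSelf_prod]
    have h3 : ContMDiffOn (𝓘(ℝ, BaseModel n).prod 𝓘(ℝ, EF)) (𝓘(ℝ, BaseModel n).prod 𝓘(ℝ, EF)) ∞
        (Prod.map c.symm f.symm) (c.target ×ˢ f.target) := hc2.prodMap hf2
    have hm : ∀ z ∈ (Φ.trans (c.prod f)).target,
        z ∈ c.target ×ˢ f.target ∧ Prod.map c.symm f.symm z ∈ Φ.target := by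
      intro z hz
      simpa [OpenPartialHomeomorph.trans_target, Prod.map] using hz
    have := h2.comp (h3.mono fun z hz => (hm z hz).1) (fun z hz => (hm z hz).2)
    exact this
  · intro z hz
    rw [← hp z (hmem z hz).1]
    exact (hmem z hz).2.1
  · intro z hz
    rw [← hp z (hmem z hz).1]
    simp
  · simp only [OpenPartialHomeomorph.trans_source, mem_inter_iff, mem_preimage]
    refine ⟨hyΦ, ?_⟩
    have : (Φ y).1 ∈ c.source := by rw [hp y hyΦ]; exact mem_chart_source _ _
    simpa using ⟨this, mem_chart_source EF (Φ y).2⟩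

variable (B : FibreBundle n EY EF X Y F)

/-- The tangent map `T_y Y → T_x X` of the bundle projection, `x = π(y)`. -/
def dproj (y : Y) : EY →L[ℝ] BaseModel n := tangentMapAt EY (BaseModel n) B.proj y

/-- The vertical tangent space `V_y Y ⊆ T_y Y`. -/
abbrev vert (y : Y) : Submodule ℝ EY := (B.dproj y).ker


namespace AdaptedChart

variable {B} (A : B.AdaptedChart) {y : Y}

theorem mdifferentiable_total : A.total.MDifferentiable 𝓘(ℝ, EY) 𝓘(ℝ, BaseModel n × EF) :=
  ⟨A.contMDiffOn_total.mdifferentiableOn (by simp),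
    A.contMDiffOn_total_symm.mdifferentiableOn (by simp)⟩

theorem mdifferentiable_base :
    A.base.MDifferentiable 𝓘(ℝ, BaseModel n) 𝓘(ℝ, BaseModel n) :=
  ⟨A.contMDiffOn_base.mdifferentiableOn (by simp),
    A.contMDiffOn_base_symm.mdifferentiableOn (by simp)⟩

/-- The components `v ↦ (dx^λ(v), dy^i(v))` of tangent vectors `v ∈ T_y Y` in the fibred
coordinates. -/
def dTotal (hy : y ∈ A.total.source) : EY ≃L[ℝ] BaseModel n × EF :=
  A.mdifferentiable_total.mfderiv hy

/-- The components `ξ ↦ dx^λ(ξ)` of tangent vectors `ξ ∈ T_x X`, `x = π(y)`. -/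
def dBase (hy : y ∈ A.total.source) : BaseModel n ≃L[ℝ] BaseModel n :=
  A.mdifferentiable_base.mfderiv (A.proj_mem y hy)

theorem dBase_dproj (hy : y ∈ A.total.source) (v : EY) :
    A.dBase hy (B.dproj y v) = (A.dTotal hy v).1 := by
  have h1 : MDifferentiableAt 𝓘(ℝ, BaseModel n) 𝓘(ℝ, BaseModel n) A.base (B.proj y) :=
    A.mdifferentiable_base.mdifferentiableAt (A.proj_mem y hy)
  have h2 : MDifferentiableAt 𝓘(ℝ, EY) 𝓘(ℝ, BaseModel n) B.proj y :=
    B.isSmoothFibreBundle.contMDiff.mdifferentiableAt (by simp)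
  have h3 : MDifferentiableAt 𝓘(ℝ, EY) 𝓘(ℝ, BaseModel n × EF) A.total y :=
    A.mdifferentiable_total.mdifferentiableAt hy
  have e1 := mfderiv_comp y h1 h2
  have h4 : MDifferentiableAt 𝓘(ℝ, BaseModel n × EF) 𝓘(ℝ, BaseModel n)
      (Prod.fst : BaseModel n × EF → BaseModel n) (A.total y) :=
    differentiableAt_fst.mdifferentiableAt
  have e2 := mfderiv_comp y h4 h3
  have e3 : (Prod.fst ∘ A.total) =ᶠ[𝓝 y] (A.base ∘ B.proj) :=
    Filter.eventuallyEq_of_mem (A.total.open_source.mem_nhds hy) A.fst_total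
  have e4 := e3.mfderiv_eq (I := 𝓘(ℝ, EY)) (I' := 𝓘(ℝ, BaseModel n))
  have e5 : mfderiv 𝓘(ℝ, BaseModel n × EF) 𝓘(ℝ, BaseModel n)
      (Prod.fst : BaseModel n × EF → BaseModel n) (A.total y) =
      ContinuousLinearMap.fst ℝ (BaseModel n) EF := by
    rw [mfderiv_eq_fderiv]
    exact fderiv_fst
  have e6 := (e2.symm.trans e4).trans e1
  have e7 := congrArg (fun l => l v) e6
  rw [e5] at e7
  exact e7.symm

theorem dproj_dTotal_symm (hy : y ∈ A.total.source) (w : BaseModel n × EF) :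
    B.dproj y ((A.dTotal hy).symm w) = (A.dBase hy).symm w.1 := by
  apply (A.dBase hy).injective
  rw [A.dBase_dproj hy]
  simp

/-- The components `v ↦ dy^i(v)` of vertical tangent vectors `v ∈ V_y Y`. -/
def dVert (hy : y ∈ A.total.source) : B.vert y ≃L[ℝ] EF where
  toFun v := (A.dTotal hy v).2
  invFun w := ⟨(A.dTotal hy).symm (0, w), by
    show B.dproj y _ = 0
    rw [A.dproj_dTotal_symm hy]
    simp⟩
  map_add' := by simp
  map_smul' := by simp
  left_inv := by
    intro v
    apply Subtype.ext
    have h : (A.dTotal hy v).1 = 0 := by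
      rw [← A.dBase_dproj hy]
      have : B.dproj y v = 0 := v.2
      rw [this, map_zero]
    have h2 : ((0 : BaseModel n), (A.dTotal hy v).2) = A.dTotal hy v := by rw [← h]
    show (A.dTotal hy).symm (0, (A.dTotal hy v).2) = v
    rw [h2]
    simp
  right_inv := by intro w; simp
  continuous_toFun := by fun_prop
  continuous_invFun := by fun_prop

end AdaptedChart

/-! ### Smooth bundles over `Y` given by fibre coordinates -/

/-- Fibre coordinates for a family `Fib y`, `y ∈ Y`, of fibres: every system of fibred coordinates
of `Y` induces a bijection of `Fib y` onto a normed space `V`, with smooth transition functions. -/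
structure FibreAtlas (Fib : Y → Type*) (V : Type*) [NormedAddCommGroup V] [NormedSpace ℝ V] where
  coord : ∀ (A : B.AdaptedChart) {y : Y}, y ∈ A.total.source → (Fib y ≃ V)
  smooth_transition : ∀ A A' : B.AdaptedChart, ∃ g : (BaseModel n × EF) × V → V,
    ContDiffOn ℝ ∞ g ((A.total.symm.trans A'.total).source ×ˢ univ) ∧
    ∀ (y : Y) (hy : y ∈ A.total.source) (hy' : y ∈ A'.total.source) (v : V),
      coord A' hy' ((coord A hy).symm v) = g (A.total y, v)

namespace FibreAtlas

variable {B} {Fib : Y → Type*} {V : Type*} [NormedAddCommGroup V] [NormedSpace ℝ V]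
  [IsManifold 𝓘(ℝ, BaseModel n) ∞ X] [IsManifold 𝓘(ℝ, EF) ∞ F]
  (S : B.FibreAtlas Fib V)

theorem nonempty_fibre (S : B.FibreAtlas Fib V) (y : Y) : Nonempty (Fib y) := by
  obtain ⟨A, hA⟩ := B.exists_adaptedChart y
  exact ⟨(S.coord A hA).symm 0⟩

open Classical in
/-- The chart `(y, f) ↦ (coordinates of y, coordinates of f)` of the total space (the values
outside of the source and the target are irrelevant). -/
def chart (A : B.AdaptedChart) : PartialEquiv (Σ y, Fib y) ((BaseModel n × EF) × V) where
  toFun p := (A.total p.1, if h : p.1 ∈ A.total.source then S.coord A h p.2 else 0)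
  invFun q := ⟨A.total.symm q.1, if h : A.total.symm q.1 ∈ A.total.source
    then (S.coord A h).symm q.2 else (S.nonempty_fibre _).some⟩
  source := {p | p.1 ∈ A.total.source}
  target := A.total.target ×ˢ univ
  map_source' p hp := ⟨A.total.map_source hp, mem_univ _⟩
  map_target' q hq := A.total.map_target hq.1
  left_inv' := by
    rintro ⟨y, f⟩ (hy : y ∈ A.total.source)
    have key : ∀ z : Y, z = y → (⟨z, if h : z ∈ A.total.source then
        (S.coord A h).symm (S.coord A hy f) else (S.nonempty_fibre _).some⟩ : Σ y, Fib y) =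
        ⟨y, f⟩ := by
      rintro z rfl
      simp [hy]
    simpa [hy] using key _ (A.total.left_inv hy)
  right_inv' := by
    rintro ⟨q, v⟩ ⟨hq, -⟩
    have hq' := A.total.map_target hq
    simp [hq', A.total.right_inv hq]

theorem mem_chart_source (A : B.AdaptedChart) (p : Σ y, Fib y) :
    p ∈ (S.chart A).source ↔ p.1 ∈ A.total.source := Iff.rfl

theorem chart_target (A : B.AdaptedChart) : (S.chart A).target = A.total.target ×ˢ univ := rfl

theorem chart_apply (A : B.AdaptedChart) (p : Σ y, Fib y) (hp : p.1 ∈ A.total.source) :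
    S.chart A p = (A.total p.1, S.coord A hp p.2) :=
  Prod.ext rfl (dif_pos hp)

theorem chart_symm_fst (A : B.AdaptedChart) (q : (BaseModel n × EF) × V) :
    ((S.chart A).symm q).1 = A.total.symm q.1 := rfl

theorem chart_symm_snd (A : B.AdaptedChart) (q : (BaseModel n × EF) × V)
    (hq : A.total.symm q.1 ∈ A.total.source) :
    ((S.chart A).symm q).2 = (S.coord A hq).symm q.2 := dif_pos hq

theorem chart_transition (A A' : B.AdaptedChart) :
    ((S.chart A).symm.trans (S.chart A')).source = (A.total.symm.trans A'.total).source ×ˢ univ ∧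
    ContDiffOn ℝ ∞ ((S.chart A).symm.trans (S.chart A'))
      ((S.chart A).symm.trans (S.chart A')).source := by
  have hs : ((S.chart A).symm.trans (S.chart A')).source =
      (A.total.symm.trans A'.total).source ×ˢ univ := by
    ext ⟨q, v⟩
    simp [S.mem_chart_source, S.chart_target, S.chart_symm_fst, PartialEquiv.trans_source]
  refine ⟨hs, ?_⟩
  rw [hs]
  obtain ⟨g, hg, hgeq⟩ := S.smooth_transition A A'
  have h1 : ContDiffOn ℝ ∞ (A'.total ∘ A.total.symm) (A.total.symm.trans A'.total).source := by
    rw [← contMDiffOn_iff_contDiffOn]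
    refine A'.contMDiffOn_total.comp (A.contMDiffOn_total_symm.mono ?_) ?_
    · intro q hq
      simp only [OpenPartialHomeomorph.trans_source] at hq
      exact hq.1
    · intro q hq
      simp only [OpenPartialHomeomorph.trans_source] at hq
      exact hq.2
  have h2 : ContDiffOn ℝ ∞ (fun p : (BaseModel n × EF) × V => (A'.total (A.total.symm p.1), g p))
      ((A.total.symm.trans A'.total).source ×ˢ univ) :=
    (h1.comp contDiffOn_fst (fun p hp => hp.1)).prodMk hg
  refine h2.congr ?_
  rintro ⟨q, v⟩ ⟨hq, -⟩
  simp only [OpenPartialHomeomorph.trans_source] at hq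
  have hq1 : A.total.symm q ∈ A.total.source := A.total.map_target hq.1
  have hq2 : A.total.symm q ∈ A'.total.source := hq.2
  have := hgeq _ hq1 hq2 v
  rw [A.total.right_inv hq.1] at this
  rw [PartialEquiv.coe_trans, Function.comp_apply, S.chart_apply A' _ hq2,
    S.chart_symm_snd A (q, v) hq1]
  exact Prod.ext rfl this

/-- The total space of a family with fibre coordinates, as a charted space. -/
def core : ChartedSpaceCore ((BaseModel n × EF) × V) (Σ y, Fib y) where
  atlas := range S.chart
  chartAt p := S.chart (B.exists_adaptedChart p.1).choose
  mem_chart_source p := (B.exists_adaptedChart p.1).choose_spec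
  chart_mem_atlas p := mem_range_self _
  open_source := by
    rintro _ _ ⟨A, rfl⟩ ⟨A', rfl⟩
    rw [(S.chart_transition A A').1]
    exact (OpenPartialHomeomorph.open_source _).prod isOpen_univ
  continuousOn_toFun := by
    rintro _ _ ⟨A, rfl⟩ ⟨A', rfl⟩
    exact (S.chart_transition A A').2.continuousOn

theorem isManifold_core :
    @IsManifold ℝ _ _ _ _ _ _ 𝓘(ℝ, (BaseModel n × EF) × V) ∞ (Σ y, Fib y)
      S.core.toTopologicalSpace S.core.toChartedSpace := by
  let _ := S.core.toTopologicalSpace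
  let _ := S.core.toChartedSpace
  refine isManifold_of_contDiffOn _ _ _ ?_
  intro e e' he he'
  obtain ⟨e₀, he₀⟩ := mem_iUnion.1 he
  obtain ⟨he₁, he₂⟩ := mem_iUnion.1 he₀
  obtain ⟨e₀', he₀'⟩ := mem_iUnion.1 he'
  obtain ⟨he₁', he₂'⟩ := mem_iUnion.1 he₀'
  obtain ⟨A, rfl⟩ := he₁
  obtain ⟨A', rfl⟩ := he₁'
  rw [mem_singleton_iff] at he₂ he₂'
  subst he₂ he₂'
  simp only [modelWithCornersSelf_coe, modelWithCornersSelf_coe_symm, Function.comp_id,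
    Function.id_comp, range_id, inter_univ, preimage_id]
  exact (S.chart_transition A A').2

end FibreAtlas

/-! ### Transition functions of the tangent components -/

namespace AdaptedChart

variable {B}

theorem contDiffOn_total_transition (A A' : B.AdaptedChart) :
    ContDiffOn ℝ ∞ (A'.total ∘ A.total.symm) (A.total.symm.trans A'.total).source := by
  rw [← contMDiffOn_iff_contDiffOn]
  refine A'.contMDiffOn_total.comp (A.contMDiffOn_total_symm.mono ?_) ?_
  · intro q hq
    simp only [OpenPartialHomeomorph.trans_source] at hq
    exact hq.1
  · intro q hq
    simp only [OpenPartialHomeomorph.trans_source] at hq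
    exact hq.2

theorem contDiffOn_base_transition (A A' : B.AdaptedChart) :
    ContDiffOn ℝ ∞ (A'.base ∘ A.base.symm) (A.base.symm.trans A'.base).source := by
  rw [← contMDiffOn_iff_contDiffOn]
  refine A'.contMDiffOn_base.comp (A.contMDiffOn_base_symm.mono ?_) ?_
  · intro q hq
    simp only [OpenPartialHomeomorph.trans_source] at hq
    exact hq.1
  · intro q hq
    simp only [OpenPartialHomeomorph.trans_source] at hq
    exact hq.2

/-- The Jacobian of the change of fibred coordinates. -/
def jacTotal (A A' : B.AdaptedChart) (q : BaseModel n × EF) :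
    (BaseModel n × EF) →L[ℝ] BaseModel n × EF :=
  fderiv ℝ (A'.total ∘ A.total.symm) q

/-- The Jacobian of the change of coordinates on the base. -/
def jacBase (A A' : B.AdaptedChart) (q : BaseModel n × EF) : BaseModel n →L[ℝ] BaseModel n :=
  fderiv ℝ (A'.base ∘ A.base.symm) q.1

variable (A A' : B.AdaptedChart)

theorem fst_mem_of_mem {q : BaseModel n × EF} (hq : q ∈ (A.total.symm.trans A'.total).source) :
    q.1 ∈ (A.base.symm.trans A'.base).source := by
  simp only [OpenPartialHomeomorph.trans_source] at hq ⊢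
  have hy : A.total.symm q ∈ A.total.source := A.total.map_target hq.1
  have h1 := A.fst_total _ hy
  rw [A.total.right_inv hq.1] at h1
  have h2 := A.proj_mem _ hy
  have h3 : A.base.symm q.1 = B.proj (A.total.symm q) := by rw [h1, A.base.left_inv h2]
  refine ⟨?_, ?_⟩
  · rw [h1]; exact A.base.map_source h2
  · show A.base.symm q.1 ∈ A'.base.source
    rw [h3]; exact A'.proj_mem _ hq.2

theorem contDiffOn_jacTotal :
    ContDiffOn ℝ ∞ (A.jacTotal A') (A.total.symm.trans A'.total).source :=
  (A.contDiffOn_total_transition A').fderiv_of_isOpen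
    (OpenPartialHomeomorph.open_source _) (by simp)

theorem contDiffOn_jacBase :
    ContDiffOn ℝ ∞ (A.jacBase A') (A.total.symm.trans A'.total).source :=
  ((A.contDiffOn_base_transition A').fderiv_of_isOpen
    (OpenPartialHomeomorph.open_source _) (m := ∞) (by simp)).comp contDiffOn_fst
      (fun _ hq => A.fst_mem_of_mem A' hq)

theorem mapsTo_transition : MapsTo (A'.total ∘ A.total.symm)
    (A.total.symm.trans A'.total).source (A'.total.symm.trans A.total).source := by
  intro q hq
  simp only [OpenPartialHomeomorph.trans_source] at hq ⊢
  refine ⟨A'.total.map_source hq.2, ?_⟩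
  show A'.total.symm (A'.total (A.total.symm q)) ∈ A.total.source
  rw [A'.total.left_inv hq.2]
  exact A.total.map_target hq.1

theorem contDiffOn_jacTotal_inv :
    ContDiffOn ℝ ∞ (fun q => A'.jacTotal A (A'.total (A.total.symm q)))
      (A.total.symm.trans A'.total).source :=
  (A'.contDiffOn_jacTotal A).comp (A.contDiffOn_total_transition A') (A.mapsTo_transition A')

theorem contDiffOn_jacBase_inv :
    ContDiffOn ℝ ∞ (fun q => A'.jacBase A (A'.total (A.total.symm q)))
      (A.total.symm.trans A'.total).source :=
  (A'.contDiffOn_jacBase A).comp (A.contDiffOn_total_transition A') (A.mapsTo_transition A')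

variable {A A'} {y : Y}

theorem jacTotal_eq (hy : y ∈ A.total.source) (hy' : y ∈ A'.total.source) :
    A.jacTotal A' (A.total y) =
      (A'.dTotal hy' : EY →L[ℝ] BaseModel n × EF) ∘L
        ((A.dTotal hy).symm : BaseModel n × EF →L[ℝ] EY) := by
  have h1 : MDifferentiableAt 𝓘(ℝ, BaseModel n × EF) 𝓘(ℝ, EY) A.total.symm (A.total y) :=
    A.mdifferentiable_total.mdifferentiableAt_symm (A.total.map_source hy)
  have h2 : MDifferentiableAt 𝓘(ℝ, EY) 𝓘(ℝ, BaseModel n × EF) A'.total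
      (A.total.symm (A.total y)) := by
    rw [A.total.left_inv hy]
    exact A'.mdifferentiable_total.mdifferentiableAt hy'
  have e := mfderiv_comp (A.total y) h2 h1
  rw [mfderiv_eq_fderiv, A.total.left_inv hy] at e
  exact e

theorem jacBase_eq (hy : y ∈ A.total.source) (hy' : y ∈ A'.total.source) :
    A.jacBase A' (A.total y) =
      (A'.dBase hy' : BaseModel n →L[ℝ] BaseModel n) ∘L
        ((A.dBase hy).symm : BaseModel n →L[ℝ] BaseModel n) := by
  have hx := A.proj_mem y hy
  have hx' := A'.proj_mem y hy'
  have h1 : MDifferentiableAt 𝓘(ℝ, BaseModel n) 𝓘(ℝ, BaseModel n) A.base.symm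
      (A.base (B.proj y)) :=
    A.mdifferentiable_base.mdifferentiableAt_symm (A.base.map_source hx)
  have h2 : MDifferentiableAt 𝓘(ℝ, BaseModel n) 𝓘(ℝ, BaseModel n) A'.base
      (A.base.symm (A.base (B.proj y))) := by
    rw [A.base.left_inv hx]
    exact A'.mdifferentiable_base.mdifferentiableAt hx'
  have e := mfderiv_comp (A.base (B.proj y)) h2 h1
  rw [mfderiv_eq_fderiv, A.base.left_inv hx, ← A.fst_total y hy] at e
  unfold jacBase
  rw [e, A.fst_total y hy]
  rfl

end AdaptedChart

end FibreBundle

section Auxiliary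

variable {P V W E E' : Type*} [NormedAddCommGroup P] [NormedSpace ℝ P]
  [NormedAddCommGroup V] [NormedSpace ℝ V] [NormedAddCommGroup W] [NormedSpace ℝ W]
  [NormedAddCommGroup E] [NormedSpace ℝ E] [NormedAddCommGroup E'] [NormedSpace ℝ E']

theorem finiteDimensional_multilinear [FiniteDimensional ℝ E] {k : ℕ} :
    FiniteDimensional ℝ (ContinuousMultilinearMap ℝ (fun _ : Fin k => E) ℝ) := by
  let l : ContinuousMultilinearMap ℝ (fun _ : Fin k => E) ℝ →ₗ[ℝ]
      MultilinearMap ℝ (fun _ : Fin k => E) ℝ :=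
    { toFun := fun f => f.toMultilinearMap
      map_add' := fun _ _ => rfl
      map_smul' := fun _ _ => rfl }
  refine Module.Finite.of_injective l ?_
  intro f g h
  ext v
  exact congrArg (fun m => m v) h

theorem finiteDimensional_alternating [FiniteDimensional ℝ E] {k : ℕ} :
    FiniteDimensional ℝ (E [⋀^Fin k]→L[ℝ] ℝ) := by
  have := finiteDimensional_multilinear (E := E) (k := k)
  refine Module.Finite.of_injective
    (ContinuousAlternatingMap.toContinuousMultilinearMapCLM ℝ :
      E [⋀^Fin k]→L[ℝ] ℝ →L[ℝ] _).toLinearMap ?_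
  intro f g h
  ext v
  exact congrArg (fun m => m v) h

/-- Pull-back of alternating forms by linear maps depends smoothly on both. -/
theorem contDiffOn_alternating_comp [FiniteDimensional ℝ E] {k : ℕ}
    {s : Set P} {z : P → E' [⋀^Fin k]→L[ℝ] ℝ} {T : P → E →L[ℝ] E'}
    (hz : ContDiffOn ℝ ∞ z s) (hT : ContDiffOn ℝ ∞ T s) :
    ContDiffOn ℝ ∞ (fun p => (z p).compContinuousLinearMap (T p)) s := by
  have := finiteDimensional_multilinear (E := E) (k := k)
  let ι : E [⋀^Fin k]→L[ℝ] ℝ →L[ℝ] ContinuousMultilinearMap ℝ (fun _ : Fin k => E) ℝ :=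
    ContinuousAlternatingMap.toContinuousMultilinearMapCLM ℝ
  let ι' : E' [⋀^Fin k]→L[ℝ] ℝ →L[ℝ] ContinuousMultilinearMap ℝ (fun _ : Fin k => E') ℝ :=
    ContinuousAlternatingMap.toContinuousMultilinearMapCLM ℝ
  have hinj : Function.Injective ι := by
    intro f g h
    ext v
    exact congrArg (fun m => m v) h
  obtain ⟨r, hr⟩ := ContinuousLinearMap.HasLeftInverse.of_injective_of_finiteDimensional hinj
  have h1 : ContDiffOn ℝ ∞ (fun p =>
      ContinuousMultilinearMap.compContinuousLinearMapContinuousMultilinear ℝ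
        (fun _ : Fin k => E) (fun _ => E') ℝ (fun _ => T p) (ι' (z p))) s := by
    refine ContDiffOn.clm_apply ?_ (ι'.contDiff.comp_contDiffOn hz)
    exact (ContinuousMultilinearMap.contDiff _).comp_contDiffOn
      (contDiffOn_pi.2 fun _ => hT)
  refine (r.contDiff.comp_contDiffOn h1).congr ?_
  intro p _
  exact (hr ((z p).compContinuousLinearMap (T p))).symm

/-- The change of coordinates in `V^* ⊗ E ⊗ ⋀^k E^*`, viewed as the space of bilinear maps
`V × E^* → ⋀^k E^*`. -/
def momentumChange {k : ℕ} (R : V →L[ℝ] V) (K S : E →L[ℝ] E)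
    (p : V →L[ℝ] (E →L[ℝ] ℝ) →L[ℝ] (E [⋀^Fin k]→L[ℝ] ℝ)) :
    V →L[ℝ] (E →L[ℝ] ℝ) →L[ℝ] (E [⋀^Fin k]→L[ℝ] ℝ) :=
  ((ContinuousLinearMap.compL ℝ (E →L[ℝ] ℝ) _ _
      (ContinuousAlternatingMap.compContinuousLinearMapCLM S)) ∘L
    ((ContinuousLinearMap.compL ℝ (E →L[ℝ] ℝ) (E →L[ℝ] ℝ) _).flip
      ((ContinuousLinearMap.compL ℝ E E ℝ).flip K))) ∘L p ∘L R

theorem momentumChange_apply {k : ℕ} (R : V →L[ℝ] V) (K S : E →L[ℝ] E)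
    (p : V →L[ℝ] (E →L[ℝ] ℝ) →L[ℝ] (E [⋀^Fin k]→L[ℝ] ℝ)) (w : V) (α : E →L[ℝ] ℝ) :
    momentumChange R K S p w α = (p (R w) (α ∘L K)).compContinuousLinearMap S := rfl

theorem contDiffOn_momentumChange [FiniteDimensional ℝ V] [FiniteDimensional ℝ E] {k : ℕ}
    {s : Set P} {R : P → V →L[ℝ] V} {K S : P → E →L[ℝ] E}
    {p : P → V →L[ℝ] (E →L[ℝ] ℝ) →L[ℝ] (E [⋀^Fin k]→L[ℝ] ℝ)}
    (hR : ContDiffOn ℝ ∞ R s) (hK : ContDiffOn ℝ ∞ K s) (hS : ContDiffOn ℝ ∞ S s)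
    (hp : ContDiffOn ℝ ∞ p s) :
    ContDiffOn ℝ ∞ (fun x => momentumChange (R x) (K x) (S x) (p x)) s := by
  refine contDiffOn_clm_apply.2 fun w => contDiffOn_clm_apply.2 fun α => ?_
  simp only [momentumChange_apply]
  exact contDiffOn_alternating_comp ((hp.clm_apply (hR.clm_apply contDiffOn_const)).clm_apply
    (contDiffOn_const.clm_comp hK)) hS

end Auxiliary

namespace FibreBundle

variable {n : ℕ} {EY EF X Y F : Type*}
  [NormedAddCommGroup EY] [NormedSpace ℝ EY] [NormedAddCommGroup EF] [NormedSpace ℝ EF]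
  [TopologicalSpace X] [ChartedSpace (BaseModel n) X]
  [TopologicalSpace Y] [ChartedSpace EY Y]
  [TopologicalSpace F] [ChartedSpace EF F]
  (B : FibreBundle n EY EF X Y F)

/-! ### The jet bundle `J¹Y`, the Legendre bundle `Π` and the homogeneous Legendre bundle `Z_Y` -/

/-- The fibre of `J¹Y → Y` at `y`: the first jets at `x = π(y)` of sections through `y`, i.e. the
linear maps `T_x X → T_y Y` which are right inverse to `T_y Y → T_x X`. -/
abbrev JetFibre (y : Y) : Type _ :=
  {j : BaseModel n →L[ℝ] EY // B.dproj y ∘L j = ContinuousLinearMap.id ℝ _}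

/-- The fibre `⋀^{n+1} T^*_x X ⊗ V^*_y Y ⊗ T_x X` of the Legendre bundle at `y` (where
`dim X = n + 1` and `x = π(y)`), as the space of bilinear maps
`V_y Y × T^*_x X → ⋀^{n+1} T^*_x X`. -/
abbrev LegendreFibre (y : Y) : Type _ :=
  B.vert y →L[ℝ] (BaseModel n →L[ℝ] ℝ) →L[ℝ] (BaseModel n [⋀^Fin (n + 1)]→L[ℝ] ℝ)

/-- The forms which vanish as soon as two of their arguments lie in `K`. -/
def formsVanishingOnTwo {E : Type*} [NormedAddCommGroup E] [NormedSpace ℝ E]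
    (K : Submodule ℝ E) (k : ℕ) : Submodule ℝ (E [⋀^Fin k]→L[ℝ] ℝ) where
  carrier := {z | ∀ v : Fin k → E, ∀ a b : Fin k, a ≠ b → v a ∈ K → v b ∈ K → z v = 0}
  add_mem' := by
    intro z w hz hw v a b hab ha hb
    simp [hz v a b hab ha hb, hw v a b hab ha hb]
  zero_mem' := by intro v a b _ _ _; simp
  smul_mem' := by
    intro c z hz v a b hab ha hb
    simp [hz v a b hab ha hb]

/-- The fibre of `Z_Y = T^*Y ∧ (⋀^n T^*X) ⊆ ⋀^{n+1} T^*Y` at `y`: the `(n+1)`-forms on `T_y Y` which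
vanish when two of their arguments are vertical. -/
abbrev HomLegendreFibre (y : Y) : Type _ := formsVanishingOnTwo (B.vert y) (n + 1)

/-- Jet coordinates `y^i_λ`: a jet is `∂_λ ↦ ∂_λ + y^i_λ ∂_i` in fibred coordinates. -/
def jetAtlas : B.FibreAtlas B.JetFibre (BaseModel n →L[ℝ] EF) where
  coord A y hy :=
    { toFun := fun j => ContinuousLinearMap.snd ℝ (BaseModel n) EF ∘L
        (A.dTotal hy : EY →L[ℝ] BaseModel n × EF) ∘L j.1 ∘L
        ((A.dBase hy).symm : BaseModel n →L[ℝ] BaseModel n)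
      invFun := fun v => ⟨((A.dTotal hy).symm : BaseModel n × EF →L[ℝ] EY) ∘L
        ((ContinuousLinearMap.id ℝ (BaseModel n)).prod v) ∘L
        (A.dBase hy : BaseModel n →L[ℝ] BaseModel n), by
          ext1 ξ
          simp [A.dproj_dTotal_symm hy]⟩
      left_inv := by
        rintro ⟨j, hj⟩
        apply Subtype.ext
        ext1 ξ
        apply (A.dTotal hy).injective
        have h1 : (A.dTotal hy (j ξ)).1 = A.dBase hy ξ := by
          rw [← A.dBase_dproj hy]
          exact congrArg (A.dBase hy) (congrArg (fun l => l ξ) hj)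
        have h2 : ((A.dBase hy).symm (A.dBase hy ξ)) = ξ := by simp
        have h3 : (A.dBase hy ξ, (A.dTotal hy (j ((A.dBase hy).symm (A.dBase hy ξ)))).2) =
            A.dTotal hy (j ξ) := by
          rw [h2, ← h1]
        exact ((A.dTotal hy).apply_symm_apply _).trans h3
      right_inv := by
        intro v
        ext1 ξ
        simp }
  smooth_transition A A' := by
    refine ⟨fun p => ContinuousLinearMap.snd ℝ (BaseModel n) EF ∘L (A.jacTotal A' p.1) ∘L
      ((ContinuousLinearMap.id ℝ (BaseModel n)).prod p.2) ∘L
      (A'.jacBase A (A'.total (A.total.symm p.1))), ?_, ?_⟩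
    · have hfst : MapsTo (Prod.fst : (BaseModel n × EF) × (BaseModel n →L[ℝ] EF) → _)
          ((A.total.symm.trans A'.total).source ×ˢ univ) (A.total.symm.trans A'.total).source :=
        fun p hp => hp.1
      refine contDiffOn_const.clm_comp
        (((A.contDiffOn_jacTotal A').comp contDiffOn_fst hfst).clm_comp
          (ContDiffOn.clm_comp ?_ ((A.contDiffOn_jacBase_inv A').comp contDiffOn_fst hfst)))
      have : ContDiff ℝ ∞ (fun v : BaseModel n →L[ℝ] EF =>
          (ContinuousLinearMap.id ℝ (BaseModel n)).prod v) := by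
        have h : (fun v : BaseModel n →L[ℝ] EF =>
            (ContinuousLinearMap.id ℝ (BaseModel n)).prod v) = fun v =>
            ContinuousLinearMap.inl ℝ (BaseModel n) EF +
              ContinuousLinearMap.inr ℝ (BaseModel n) EF ∘L v := by
          ext v ξ <;> simp
        rw [h]
        fun_prop
      exact this.comp_contDiffOn contDiffOn_snd
    · intro y hy hy' v
      beta_reduce
      dsimp only
      rw [A.total.left_inv hy, AdaptedChart.jacTotal_eq hy hy', AdaptedChart.jacBase_eq hy' hy]
      rfl

/-- Momentum coordinates `p^λ_i` on the Legendre bundle. -/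
def legendreAtlas [FiniteDimensional ℝ EF] : B.FibreAtlas B.LegendreFibre
    (EF →L[ℝ] (BaseModel n →L[ℝ] ℝ) →L[ℝ] (BaseModel n [⋀^Fin (n + 1)]→L[ℝ] ℝ)) where
  coord A y hy := ((A.dVert hy).arrowCongr
    (((A.dBase hy).arrowCongr (ContinuousLinearEquiv.refl ℝ ℝ)).arrowCongr
      ((A.dBase hy).continuousAlternatingMapCongrLeft))).toEquiv
  smooth_transition A A' := by
    refine ⟨fun p => momentumChange
      (ContinuousLinearMap.snd ℝ (BaseModel n) EF ∘L
        A'.jacTotal A (A'.total (A.total.symm p.1)) ∘L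
        ContinuousLinearMap.inr ℝ (BaseModel n) EF)
      (A.jacBase A' p.1) (A'.jacBase A (A'.total (A.total.symm p.1))) p.2, ?_, ?_⟩
    · have hfst : MapsTo (Prod.fst : (BaseModel n × EF) × (EF →L[ℝ] (BaseModel n →L[ℝ] ℝ) →L[ℝ]
          (BaseModel n [⋀^Fin (n + 1)]→L[ℝ] ℝ)) → _)
          ((A.total.symm.trans A'.total).source ×ˢ univ) (A.total.symm.trans A'.total).source :=
        fun p hp => hp.1
      have h1 := (A.contDiffOn_jacBase_inv A').comp contDiffOn_fst hfst
      have h2 := (A.contDiffOn_jacBase A').comp contDiffOn_fst hfst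
      have h3 := (A.contDiffOn_jacTotal_inv A').comp contDiffOn_fst hfst
      exact contDiffOn_momentumChange
        (contDiffOn_const.clm_comp (h3.clm_comp contDiffOn_const)) h2 h1 contDiffOn_snd
    · intro y hy hy' P
      have e1 : A'.jacTotal A (A'.total (A.total.symm (A.total y))) =
          (A.dTotal hy : EY →L[ℝ] BaseModel n × EF) ∘L
            ((A'.dTotal hy').symm : BaseModel n × EF →L[ℝ] EY) := by
        rw [A.total.left_inv hy, AdaptedChart.jacTotal_eq hy' hy]
      have e2 : A'.jacBase A (A'.total (A.total.symm (A.total y))) =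
          (A.dBase hy : BaseModel n →L[ℝ] BaseModel n) ∘L
            ((A'.dBase hy').symm : BaseModel n →L[ℝ] BaseModel n) := by
        rw [A.total.left_inv hy, AdaptedChart.jacBase_eq hy' hy]
      beta_reduce
      dsimp only
      rw [e1, e2, AdaptedChart.jacBase_eq hy hy']
      ext w α ξ
      rfl

/-- Momentum coordinates `(p^λ_i, p)` on the homogeneous Legendre bundle. -/
def homLegendreAtlas [FiniteDimensional ℝ EF] : B.FibreAtlas (fun y => B.HomLegendreFibre y)
    (formsVanishingOnTwo (ContinuousLinearMap.fst ℝ (BaseModel n) EF).ker (n + 1)) where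
  coord A y hy :=
    { toFun := fun z => ⟨z.1.compContinuousLinearMap
        ((A.dTotal hy).symm : BaseModel n × EF →L[ℝ] EY), by
          intro v a b hab ha hb
          refine z.2 _ a b hab ?_ ?_
          · show B.dproj y ((A.dTotal hy).symm (v a)) = 0
            rw [A.dproj_dTotal_symm hy, show (v a).1 = 0 from ha, map_zero]
          · show B.dproj y ((A.dTotal hy).symm (v b)) = 0
            rw [A.dproj_dTotal_symm hy, show (v b).1 = 0 from hb, map_zero]⟩
      invFun := fun z => ⟨z.1.compContinuousLinearMap
        (A.dTotal hy : EY →L[ℝ] BaseModel n × EF), by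
          intro v a b hab ha hb
          refine z.2 _ a b hab ?_ ?_
          · show (A.dTotal hy (v a)).1 = 0
            rw [← A.dBase_dproj hy, show B.dproj y (v a) = 0 from ha, map_zero]
          · show (A.dTotal hy (v b)).1 = 0
            rw [← A.dBase_dproj hy, show B.dproj y (v b) = 0 from hb, map_zero]⟩
      left_inv := by
        intro z
        apply Subtype.ext
        ext v
        simp [Function.comp_def]
      right_inv := by
        intro z
        apply Subtype.ext
        ext v
        simp [Function.comp_def] }
  smooth_transition A A' := by
    have := finiteDimensional_alternating (E := BaseModel n × EF) (k := n + 1)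
    let ι := (formsVanishingOnTwo
        (ContinuousLinearMap.fst ℝ (BaseModel n) EF).ker (n + 1)).subtypeL
    have hinj : Function.Injective ι := Subtype.val_injective
    obtain ⟨r, hr⟩ := ContinuousLinearMap.HasLeftInverse.of_injective_of_finiteDimensional hinj
    refine ⟨fun p => r (p.2.1.compContinuousLinearMap
      (A'.jacTotal A (A'.total (A.total.symm p.1)))), ?_, ?_⟩
    · refine r.contDiff.comp_contDiffOn (contDiffOn_alternating_comp ?_ ?_)
      · exact ι.contDiff.comp_contDiffOn contDiffOn_snd
      · exact (A.contDiffOn_jacTotal_inv A').comp contDiffOn_fst (fun p hp => hp.1)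
    · intro y hy hy' z
      have e : A'.jacTotal A (A'.total (A.total.symm (A.total y))) =
          (A.dTotal hy : EY →L[ℝ] BaseModel n × EF) ∘L
            ((A'.dTotal hy').symm : BaseModel n × EF →L[ℝ] EY) := by
        rw [A.total.left_inv hy, AdaptedChart.jacTotal_eq hy' hy]
      beta_reduce
      dsimp only
      rw [e]
      exact (hr _).symm

/-- The jet manifold `J¹Y`; a point is a pair `(y, j)`. -/
def Jet : Type _ := Σ y : Y, B.JetFibre y

/-- The Legendre bundle `Π = ⋀^{n+1} T^*X ⊗ V^*Y ⊗ TX` (`dim X = n + 1`). -/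
def Legendre : Type _ := Σ y : Y, B.LegendreFibre y

/-- The homogeneous Legendre bundle `Z_Y = T^*Y ∧ (⋀^n T^*X)` (`dim X = n + 1`). -/
def HomLegendre : Type _ := Σ y : Y, B.HomLegendreFibre y

/-- The model space of `J¹Y`, with coordinates `(x^λ, y^i, y^i_λ)`. -/
abbrev JetModel (n : ℕ) (EF : Type*) [NormedAddCommGroup EF] [NormedSpace ℝ EF] :=
  (BaseModel n × EF) × (BaseModel n →L[ℝ] EF)

/-- The model space of `Π`, with coordinates `(x^λ, y^i, p^λ_i)`. -/
abbrev LegendreModel (n : ℕ) (EF : Type*) [NormedAddCommGroup EF] [NormedSpace ℝ EF] :=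
  (BaseModel n × EF) ×
    (EF →L[ℝ] (BaseModel n →L[ℝ] ℝ) →L[ℝ] (BaseModel n [⋀^Fin (n + 1)]→L[ℝ] ℝ))

/-- The model space of `Z_Y`, with coordinates `(x^λ, y^i, p^λ_i, p)`. -/
abbrev HomLegendreModel (n : ℕ) (EF : Type*) [NormedAddCommGroup EF] [NormedSpace ℝ EF] :=
  (BaseModel n × EF) ×
    formsVanishingOnTwo (ContinuousLinearMap.fst ℝ (BaseModel n) EF).ker (n + 1)

variable {B}

/-- The projection `J¹Y → Y`. -/
def Jet.pt (j : B.Jet) : Y := j.1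

/-- The jet `j`, as a linear map `T_x X → T_y Y`. -/
def Jet.lin (j : B.Jet) : BaseModel n →L[ℝ] EY := j.2.1

theorem Jet.dproj_lin (j : B.Jet) (ξ : BaseModel n) : B.dproj j.pt (j.lin ξ) = ξ :=
  congrArg (fun l => l ξ) j.2.2

/-- The projection `Π → Y`. -/
def Legendre.pt (q : B.Legendre) : Y := q.1

/-- The projection `Z_Y → Y`. -/
def HomLegendre.pt (z : B.HomLegendre) : Y := z.1

/-- A point of `Z_Y` over `y`, as an exterior form on `T_y Y`. -/
def HomLegendre.form (z : B.HomLegendre) : EY [⋀^Fin (n + 1)]→L[ℝ] ℝ := z.2.1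

/-- The affine structure of `J¹Y → Y`: the jet `j + w`, for `w ∈ T^*_x X ⊗ V_y Y`. -/
def Jet.addVert (j : B.Jet) (w : BaseModel n →L[ℝ] B.vert j.pt) : B.Jet :=
  ⟨j.pt, j.lin + (B.vert j.pt).subtypeL ∘L w, by
    ext1 ξ
    have h1 : B.dproj j.pt (w ξ : EY) = 0 := (w ξ).2
    have h2 := j.dproj_lin ξ
    show B.dproj j.pt (j.lin ξ + (w ξ : EY)) = ξ
    rw [map_add, h1, h2, add_zero]⟩

/-- The values of the contact forms `θ = dy - y_λ dx^λ` at the jet `j`: the vertical projection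
`T_y Y → V_y Y` along the image of `j`. -/
def Jet.contact (j : B.Jet) : EY →L[ℝ] B.vert j.pt :=
  (ContinuousLinearMap.id ℝ EY - j.lin ∘L B.dproj j.pt).codRestrict (B.vert j.pt) (by
    intro v
    show B.dproj j.pt (v - j.lin (B.dproj j.pt v)) = 0
    rw [map_sub, j.dproj_lin, sub_self])

variable (B)

variable [IsManifold 𝓘(ℝ, BaseModel n) ∞ X] [IsManifold 𝓘(ℝ, EF) ∞ F]

instance : TopologicalSpace B.Jet := B.jetAtlas.core.toTopologicalSpace

instance : ChartedSpace (JetModel n EF) B.Jet := B.jetAtlas.core.toChartedSpace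

instance : IsManifold 𝓘(ℝ, JetModel n EF) ∞ B.Jet := B.jetAtlas.isManifold_core

section

variable [FiniteDimensional ℝ EF]

instance : TopologicalSpace B.Legendre := B.legendreAtlas.core.toTopologicalSpace

instance : ChartedSpace (LegendreModel n EF) B.Legendre := B.legendreAtlas.core.toChartedSpace

instance : IsManifold 𝓘(ℝ, LegendreModel n EF) ∞ B.Legendre := B.legendreAtlas.isManifold_core

instance : TopologicalSpace B.HomLegendre := B.homLegendreAtlas.core.toTopologicalSpace

instance : ChartedSpace (HomLegendreModel n EF) B.HomLegendre :=
  B.homLegendreAtlas.core.toChartedSpace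

instance : IsManifold 𝓘(ℝ, HomLegendreModel n EF) ∞ B.HomLegendre :=
  B.homLegendreAtlas.isManifold_core

end

/-- The canonical form `Ξ_Y = p ω + p^λ_i dy^i ∧ ω_λ` on `Z_Y`: at `z` it is the pull-back of
`z ∈ ⋀^{n+1} T^*_y Y` to `Z_Y`. -/
def canonicalForm [FiniteDimensional ℝ EF] :
    DiffForm (HomLegendreModel n EF) B.HomLegendre (n + 1) :=
  fun z => z.form.compContinuousLinearMap
    (tangentMapAt (HomLegendreModel n EF) EY HomLegendre.pt z)

/-- A first order Lagrangian `L = 𝓛 ω : J¹Y → ⋀^{n+1} T^*X` (a morphism over `X`), smooth in the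
sense that in all fibred coordinates its coefficient `𝓛 = L(∂_0, …, ∂_n)` is smooth. -/
structure Lagrangian where
  toFun : B.Jet → BaseModel n [⋀^Fin (n + 1)]→L[ℝ] ℝ
  smooth : ∀ A : B.AdaptedChart, ContMDiffOn 𝓘(ℝ, JetModel n EF) 𝓘(ℝ) ∞
    (fun j : B.Jet => toFun j fun l : Fin (n + 1) =>
      tangentMapAt (BaseModel n) (BaseModel n) A.base.symm (A.base (B.proj j.pt))
        (EuclideanSpace.single l 1))
    {j | j.pt ∈ A.total.source}

namespace Lagrangian

variable {B} (L : B.Lagrangian)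

/-- The derivative of `L` at `j` along the fibre `J¹_y Y`, an affine space over
`T^*_x X ⊗ V_y Y`. -/
def fibreDeriv (j : B.Jet) :
    (BaseModel n →L[ℝ] B.vert j.pt) →L[ℝ] (BaseModel n [⋀^Fin (n + 1)]→L[ℝ] ℝ) :=
  fderiv ℝ (fun w => L.toFun (j.addVert w)) 0

/-- The momenta `π^λ_i = ∂𝓛/∂y^i_λ`: the bilinear map
`(v, α) ↦ d/dt L(j + t α ⊗ v)` at `t = 0` on `V_y Y × T^*_x X`. -/
def momentum (j : B.Jet) : B.LegendreFibre j.pt :=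
  (ContinuousLinearMap.compL ℝ (BaseModel n →L[ℝ] ℝ) (BaseModel n →L[ℝ] B.vert j.pt)
    (BaseModel n [⋀^Fin (n + 1)]→L[ℝ] ℝ) (L.fibreDeriv j)) ∘L
    (ContinuousLinearMap.smulRightL ℝ (BaseModel n) (B.vert j.pt)).flip

/-- The Legendre map `L̂ : J¹Y → Π`. -/
def legendre (j : B.Jet) : B.Legendre := ⟨j.pt, L.momentum j⟩

/-- `v ↦ π^λ_i v^i ω_λ`, i.e. the contraction of the momenta at `j` over `T_x X`. -/
def contractedMomentum (j : B.Jet) :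
    B.vert j.pt →L[ℝ] (BaseModel n [⋀^Fin n]→L[ℝ] ℝ) :=
  ∑ l : Fin (n + 1),
    (ContinuousAlternatingMap.curryLeftLI.toContinuousLinearMap.flip
        (EuclideanSpace.single l (1 : ℝ) : BaseModel n)) ∘L
      ((L.momentum j).flip (EuclideanSpace.proj l))

/-- The form `L + π^λ_i θ^i ∧ ω_λ` on `T_y Y`, for a jet `j ∈ J¹_y Y`. -/
def poincareCartanAt (j : B.Jet) : EY [⋀^Fin (n + 1)]→L[ℝ] ℝ :=
  (L.toFun j).compContinuousLinearMap (B.dproj j.pt) +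
    ContinuousAlternatingMap.alternatizeUncurryFin
      (ContinuousAlternatingMap.compContinuousLinearMapCLM (B.dproj j.pt) ∘L
        L.contractedMomentum j ∘L j.contact)

theorem poincareCartanAt_mem (j : B.Jet) :
    L.poincareCartanAt j ∈ formsVanishingOnTwo (B.vert j.pt) (n + 1) := by
  intro v a b hab ha hb
  have ha' : B.dproj j.pt (v a) = 0 := ha
  have hb' : B.dproj j.pt (v b) = 0 := hb
  have h1 : L.toFun j (fun i => B.dproj j.pt (v i)) = 0 :=
    (L.toFun j).map_coord_zero a ha'
  have h2 : ∀ (f : BaseModel n [⋀^Fin n]→L[ℝ] ℝ) (i : Fin (n + 1)),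
      f (fun k => B.dproj j.pt (i.removeNth v k)) = 0 := by
    intro f i
    by_cases hi : i = a
    · obtain ⟨k, hk⟩ := Fin.exists_succAbove_eq (show b ≠ i by rw [hi]; exact hab.symm)
      refine f.map_coord_zero k ?_
      show B.dproj j.pt (v (i.succAbove k)) = 0
      rw [hk, hb']
    · obtain ⟨k, hk⟩ := Fin.exists_succAbove_eq (show a ≠ i from fun h => hi h.symm)
      refine f.map_coord_zero k ?_
      show B.dproj j.pt (v (i.succAbove k)) = 0
      rw [hk, ha']
  have h3 : ContinuousAlternatingMap.alternatizeUncurryFin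
      (ContinuousAlternatingMap.compContinuousLinearMapCLM (B.dproj j.pt) ∘L
        L.contractedMomentum j ∘L j.contact) v = 0 := by
    rw [ContinuousAlternatingMap.alternatizeUncurryFin_apply]
    refine Finset.sum_eq_zero fun i _ => ?_
    have := h2 (L.contractedMomentum j (j.contact (v i))) i
    exact (congrArg (fun c : ℝ => (-1 : ℤ) ^ (i : ℕ) • c) this).trans (smul_zero _)
  exact (congrArg₂ (· + ·) h1 h3).trans (add_zero 0)

/-- The Poincaré–Cartan form `H_L = L + π^λ_i θ^i ∧ ω_λ` on `J¹Y`. -/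
def poincareCartan : DiffForm (JetModel n EF) B.Jet (n + 1) :=
  fun j => (L.poincareCartanAt j).compContinuousLinearMap
    (tangentMapAt (JetModel n EF) EY Jet.pt j)

/-- The Legendre morphism `Ĥ_L : J¹Y → Z_Y` defined by the Poincaré–Cartan form. -/
def homLegendre (j : B.Jet) : B.HomLegendre :=
  ⟨j.pt, L.poincareCartanAt j, L.poincareCartanAt_mem j⟩

/-- The Lagrangian constraint space `N_L = L̂(J¹Y) ⊆ Π`. -/
abbrev NSpace : Type _ := range L.legendre

/-- The space `Z_L = Ĥ_L(J¹Y) ⊆ Z_Y`. -/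
abbrev ZSpace : Type _ := range L.homLegendre

/-- The Legendre map, as a map `L̂ : J¹Y → N_L`. -/
def legendreN : B.Jet → L.NSpace := rangeFactorization L.legendre

/-- The Legendre morphism, as a map `Ĥ_L : J¹Y → Z_L`. -/
def homLegendreZ : B.Jet → L.ZSpace := rangeFactorization L.homLegendre

/-- The projection `N_L → X`. -/
def projN (q : L.NSpace) : X := B.proj q.1.pt

/-- The projection `Z_L → X`. -/
def projZ (z : L.ZSpace) : X := B.proj z.1.pt

variable [FiniteDimensional ℝ EF]

/-- `L` is almost regular (for the manifold structure, modelled on `EN`, that is given on `N_L`):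
`N_L` is a closed imbedded subbundle, with typical fibre `G`, of `Π → Y`, and `L̂ : J¹Y → N_L` is a
fibred manifold, i.e. a surjective submersion, with connected fibres. -/
structure IsAlmostRegular (EN EG G : Type*)
    [NormedAddCommGroup EN] [NormedSpace ℝ EN] [ChartedSpace EN L.NSpace]
    [NormedAddCommGroup EG] [NormedSpace ℝ EG] [TopologicalSpace G] [ChartedSpace EG G] :
    Prop where
  isClosed : IsClosed (range L.legendre)
  isSmoothEmbedding : Manifold.IsSmoothEmbedding 𝓘(ℝ, EN) 𝓘(ℝ, LegendreModel n EF) ∞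
    (Subtype.val : L.NSpace → B.Legendre)
  isSmoothFibreBundle : IsSmoothFibreBundle EY EN EG G (fun q : L.NSpace => q.1.pt)
  isSubmersion : Manifold.IsSubmersion 𝓘(ℝ, JetModel n EF) 𝓘(ℝ, EN) ∞ L.legendreN
  isConnected_fibre : ∀ q : L.NSpace, IsConnected (L.legendreN ⁻¹' {q})

/-- `Ψ` is a global (smooth) section of the fibred manifold `L̂ : J¹Y → N_L`. -/
structure IsGlobalSection (EN : Type*) [NormedAddCommGroup EN] [NormedSpace ℝ EN]
    [ChartedSpace EN L.NSpace] (Ψ : L.NSpace → B.Jet) : Prop where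
  contMDiff : ContMDiff 𝓘(ℝ, EN) 𝓘(ℝ, JetModel n EF) ∞ Ψ
  legendreN_apply : ∀ q, L.legendreN (Ψ q) = q

/-- The constrained Hamiltonian form `H_N = Ψ^* H_L`. -/
def constrainedForm (EN : Type*) [NormedAddCommGroup EN] [NormedSpace ℝ EN]
    [ChartedSpace EN L.NSpace] (Ψ : L.NSpace → B.Jet) : DiffForm EN L.NSpace (n + 1) :=
  DiffForm.pullback Ψ L.poincareCartan

/-- The De Donder form `Ξ_L = i_L^* Ξ_Y` on `Z_L`. -/
def deDonderForm (EZ : Type*) [NormedAddCommGroup EZ] [NormedSpace ℝ EZ]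
    [ChartedSpace EZ L.ZSpace] : DiffForm EZ L.ZSpace (n + 1) :=
  DiffForm.pullback (Subtype.val : L.ZSpace → B.HomLegendre) B.canonicalForm

end Lagrangian

end FibreBundle

/-! ### Sections, vertical vector fields, and the equations `r^*(u ⌋ dα) = 0` -/

section Equations

variable (n : ℕ) {X M : Type*} [TopologicalSpace X] [ChartedSpace (BaseModel n) X]
  (E : Type*) [NormedAddCommGroup E] [NormedSpace ℝ E] [TopologicalSpace M] [ChartedSpace E M]

/-- `r` is a smooth section of `p : M → X` over `U`. -/
structure IsSmoothSectionOn (p : M → X) (U : Set X) (r : X → M) : Prop where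
  contMDiffOn : ContMDiffOn 𝓘(ℝ, BaseModel n) 𝓘(ℝ, E) ∞ r U
  proj_apply : ∀ x ∈ U, p (r x) = x

variable {E} [IsManifold 𝓘(ℝ, E) ∞ M]

/-- `u` is a smooth vector field on `M` which is vertical for `p : M → X`. -/
structure IsVerticalField (p : M → X) (u : ∀ m : M, TangentSpace 𝓘(ℝ, E) m) : Prop where
  contMDiff : ContMDiff 𝓘(ℝ, E) 𝓘(ℝ, E).tangent ∞
    (fun m => (⟨m, u m⟩ : TangentBundle 𝓘(ℝ, E) M))
  vertical : ∀ m, tangentMapAt E (BaseModel n) p m (u m) = 0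

variable {n}

/-- The section `r` of `p : M → X` satisfies, at all points of `U`, the equations
`r^*(u ⌋ dα) = 0` for all vertical vector fields `u` on `M → X`. -/
def SolvesHamiltonEquations (p : M → X) (α : DiffForm E M (n + 1)) (U : Set X) (r : X → M) :
    Prop :=
  ∀ u : (∀ m : M, TangentSpace 𝓘(ℝ, E) m), IsVerticalField n p u → ∀ x ∈ U,
    ((α.d (r x)).curryLeft (u (r x))).compContinuousLinearMap
      (tangentMapAt (BaseModel n) E r x) = 0

end Equations

end

/-! The space $Z_L$ is the graph of a function over $N_L$. In fibred coordinates $\widehat H_L$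
records the momenta $\pi^\lambda_i$ together with $p = \mathcal L - \pi^\mu_i y^i_\mu$, and
$\widehat L$ records the momenta alone. Two facts therefore make $N_L$ and $Z_L$ correspond
bijectively.

First, $\widehat L$ factors through $\widehat H_L$, because the momenta can be read off the form
$p\,\omega + p^\lambda_i\,dy^i\wedge\omega_\lambda$ by a linear map
(`exists_leftInverse_cartanForm`, `legendre_eq_of_homLegendre_eq`).

Second, $\widehat H_L$ is constant on the fibres of $\widehat L$. Along a curve in such a fibre the
point of $Y$ and the momenta are fixed, so $\frac{d}{dt}\mathcal L = \pi^\lambda_i\,\dot y^i_\lambda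
= \frac{d}{dt}(\pi^\lambda_i y^i_\lambda)$ and $p$ does not change (`homLegendre_eq_of_curve`).
Since $\widehat L$ is a submersion, nearby points of a fibre are joined by such curves, so $\widehat
H_L$ is locally constant on the fibre; connectedness makes it constant
(`IsAlmostRegular.homLegendre_eq`).

Hence $\varphi = \widehat H_L\circ\Psi$ does not depend on the section $\Psi$, and its inverse sends
$\widehat H_L(j)$ to $\widehat L(j)$. Both maps are smooth because they are smooth into the ambient
bundles and $N_L$, $Z_L$ are embedded (`IsAlmostRegular.diffeomorph`). As $\Xi_Y$ is tautological,
$\widehat H_L^*\Xi_Y = H_L$, whence $\Psi^*H_L = \varphi^*\Xi_L$ (`constrainedForm_eq_pullback`).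

It remains to see that the equations $r^*(u\rfloor d\alpha)=0$ are natural under a diffeomorphism
over $X$: $d$ commutes with pull-back (`DiffForm.d_pullback`), and vertical fields are carried to
vertical fields in both directions (`solvesHamiltonEquations_pullback_iff`).

The base has dimension $n+1$ in the code, so forms of top degree are `Fin (n + 1)`-alternating. -/

noncomputable section

/-! ### Top-degree forms and the contraction of momenta over $TX$ -/

section TopForms

variable {n : ℕ} {V V' G : Type*} [NormedAddCommGroup V] [NormedSpace ℝ V]
  [NormedAddCommGroup V'] [NormedSpace ℝ V'] [NormedAddCommGroup G] [NormedSpace ℝ G]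

/-- `α ∧ (e ⌟ Ω) = α(e) Ω` for a form `Ω` of top degree. -/
theorem alternatizeUncurryFin_smulRight_curryLeft (Ω : BaseModel n [⋀^Fin (n + 1)]→L[ℝ] ℝ)
    (α : BaseModel n →L[ℝ] ℝ) (e : BaseModel n) :
    ContinuousAlternatingMap.alternatizeUncurryFin (α.smulRight (Ω.curryLeft e)) = α e • Ω := by
  ext v
  -- $\alpha\wedge\Omega$ has degree $n+2$ on a space of dimension $n+1$, so it vanishes. Evaluating
  -- it on $(e, v_0,\dots,v_n)$ and separating the term in which $\alpha$ takes $e$ gives the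
  -- identity.
  have h0 : ContinuousAlternatingMap.alternatizeUncurryFin (α.smulRight Ω)
      (Matrix.vecCons e v) = 0 := by
    refine AlternatingMap.map_linearDependent
      (ContinuousAlternatingMap.alternatizeUncurryFin (α.smulRight Ω)).toAlternatingMap _ ?_
    intro h
    have := h.fintype_card_le_finrank
    simp at this
  rw [ContinuousAlternatingMap.alternatizeUncurryFin_apply, Fin.sum_univ_succ] at h0
  rw [ContinuousAlternatingMap.alternatizeUncurryFin_apply]
  have hz : (Fin.removeNth 0 (Matrix.vecCons e v) : Fin (n + 1) → BaseModel n) = v := by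
    ext i; simp [Fin.removeNth]
  have hs : ∀ i : Fin (n + 1), (Fin.removeNth i.succ (Matrix.vecCons e v) :
      Fin (n + 1) → BaseModel n) = Matrix.vecCons e (i.removeNth v) := by
    intro i
    funext k
    refine Fin.cases ?_ (fun k => ?_) k <;> simp [Fin.removeNth]
  simp only [hz, hs, Fin.val_zero, pow_zero, one_smul, Fin.val_succ, Matrix.cons_val_zero,
    Matrix.cons_val_succ, ContinuousLinearMap.smulRight_apply, pow_succ, mul_neg, mul_one,
    neg_smul, Finset.sum_neg_distrib] at h0
  simp only [ContinuousLinearMap.smulRight_apply, ContinuousAlternatingMap.smul_apply]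
  have := eq_of_sub_eq_zero ((sub_eq_add_neg _ _).trans h0)
  exact this.symm

/-- The contraction `v ↦ p^λ_i v^i ω_λ` of `p ∈ V^* ⊗ TX ⊗ ⋀^{n+1} T^*X` over `TX`. -/
def contractTop (P : V →L[ℝ] (BaseModel n →L[ℝ] ℝ) →L[ℝ] (BaseModel n [⋀^Fin (n + 1)]→L[ℝ] ℝ)) :
    V →L[ℝ] (BaseModel n [⋀^Fin n]→L[ℝ] ℝ) :=
  ∑ l : Fin (n + 1),
    (ContinuousAlternatingMap.curryLeftLI.toContinuousLinearMap.flip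
        (EuclideanSpace.single l (1 : ℝ) : BaseModel n)) ∘L
      (P.flip (EuclideanSpace.proj l))

theorem contractTop_apply
    (P : V →L[ℝ] (BaseModel n →L[ℝ] ℝ) →L[ℝ] (BaseModel n [⋀^Fin (n + 1)]→L[ℝ] ℝ)) (v : V) :
    contractTop P v = ∑ l : Fin (n + 1), (P v (EuclideanSpace.proj l)).curryLeft
      (EuclideanSpace.single l (1 : ℝ)) := by
  simp only [contractTop, _root_.sum_apply]
  rfl

theorem contractTop_add
    (P Q : V →L[ℝ] (BaseModel n →L[ℝ] ℝ) →L[ℝ] (BaseModel n [⋀^Fin (n + 1)]→L[ℝ] ℝ)) :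
    contractTop (P + Q) = contractTop P + contractTop Q := by
  ext1 v
  simp [contractTop_apply, Finset.sum_add_distrib]

theorem contractTop_smul (c : ℝ)
    (P : V →L[ℝ] (BaseModel n →L[ℝ] ℝ) →L[ℝ] (BaseModel n [⋀^Fin (n + 1)]→L[ℝ] ℝ)) :
    contractTop (c • P) = c • contractTop P := by
  ext1 v
  simp [contractTop_apply, Finset.smul_sum]

theorem BaseModel.sum_apply_smul_single (ξ : BaseModel n) :
    ∑ l, ξ l • (EuclideanSpace.single l (1 : ℝ) : BaseModel n) = ξ := by
  ext k
  simp [Finset.sum_apply, Pi.single_apply]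

theorem BaseModel.sum_smul_proj (α : BaseModel n →L[ℝ] ℝ) :
    ∑ l, α (EuclideanSpace.single l (1 : ℝ)) •
      (EuclideanSpace.proj l : BaseModel n →L[ℝ] ℝ) = α := by
  ext ξ
  conv_rhs => rw [← BaseModel.sum_apply_smul_single ξ]
  simp [mul_comm]

/-- Contraction of a bilinear map on `E × E^*` does not depend on the basis. -/
theorem BaseModel.sum_single_proj_equiv (D : BaseModel n ≃L[ℝ] BaseModel n)
    (b : BaseModel n →ₗ[ℝ] (BaseModel n →L[ℝ] ℝ) →ₗ[ℝ] G) :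
    ∑ l, b (D (EuclideanSpace.single l 1))
      ((EuclideanSpace.proj l : BaseModel n →L[ℝ] ℝ) ∘L
        (D.symm : BaseModel n →L[ℝ] BaseModel n)) =
    ∑ l, b (EuclideanSpace.single l 1) (EuclideanSpace.proj l) := by
  -- Expand $dx^l\circ D^{-1}$ in the dual basis. After exchanging the sums, the coefficients
  -- reassemble $D D^{-1} e_m = e_m$ in the first argument.
  have h : ∀ l : Fin (n + 1), b (D (EuclideanSpace.single l 1))
      ((EuclideanSpace.proj l : BaseModel n →L[ℝ] ℝ) ∘L
        (D.symm : BaseModel n →L[ℝ] BaseModel n)) =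
      ∑ m, (D.symm (EuclideanSpace.single m 1)) l • b (D (EuclideanSpace.single l 1))
        (EuclideanSpace.proj m) := by
    intro l
    conv_lhs => rw [← BaseModel.sum_smul_proj ((EuclideanSpace.proj l : BaseModel n →L[ℝ] ℝ) ∘L
        (D.symm : BaseModel n →L[ℝ] BaseModel n))]
    simp
  rw [Finset.sum_congr rfl fun l _ => h l, Finset.sum_comm]
  refine Finset.sum_congr rfl fun m _ => ?_
  have : ∑ l, (D.symm (EuclideanSpace.single m 1)) l • D (EuclideanSpace.single l 1) =
      (EuclideanSpace.single m 1 : BaseModel n) := by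
    have h2 := congrArg D (BaseModel.sum_apply_smul_single
      (D.symm (EuclideanSpace.single m (1 : ℝ))))
    simpa using h2
  conv_rhs => rw [← this]
  simp

/-- Since $dx^m\wedge\omega_l=\delta^m_l\,\omega$, the form $p^\lambda_i
w^i_\mu\,dx^\mu\wedge\omega_\lambda$ collapses to the full contraction $p^\lambda_i
w^i_\lambda\,\omega$. This is the source of the term $-\pi^\mu_i y^i_\mu$ in the coordinate $p$. -/
theorem alternatizeUncurryFin_contractTop_comp
    (P : V →L[ℝ] (BaseModel n →L[ℝ] ℝ) →L[ℝ] (BaseModel n [⋀^Fin (n + 1)]→L[ℝ] ℝ))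
    (w : BaseModel n →L[ℝ] V) :
    ContinuousAlternatingMap.alternatizeUncurryFin (contractTop P ∘L w) =
      ∑ l, P (w (EuclideanSpace.single l 1)) (EuclideanSpace.proj l) := by
  have h : contractTop P ∘L w = ∑ l, ∑ m, (EuclideanSpace.proj m : BaseModel n →L[ℝ] ℝ).smulRight
      ((P (w (EuclideanSpace.single m 1)) (EuclideanSpace.proj l)).curryLeft
        (EuclideanSpace.single l 1)) := by
    ext1 ξ
    conv_lhs => rw [← BaseModel.sum_apply_smul_single ξ]
    simp only [ContinuousLinearMap.comp_apply, map_sum, map_smul, contractTop_apply,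
      _root_.sum_apply, ContinuousLinearMap.smulRight_apply]
    rw [Finset.sum_comm]
    refine Finset.sum_congr rfl fun m _ => ?_
    rw [Finset.smul_sum]
    rfl
  rw [h, ← ContinuousAlternatingMap.alternatizeUncurryFinCLM_apply]
  simp only [map_sum, ContinuousAlternatingMap.alternatizeUncurryFinCLM_apply,
    alternatizeUncurryFin_smulRight_curryLeft]
  refine Finset.sum_congr rfl fun l _ => ?_
  rw [Finset.sum_eq_single l]
  · simp
  · intro m _ hm
    simp [hm]
  · simp

/-- The contraction is a trace over $TX\otimes T^*X$, hence independent of the basis, and so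
commutes with linear changes of coordinates. It is defined with the standard basis of the model
space; this lemma allows it to be computed in any fibred chart. -/
theorem contractTop_arrowCongr (R : V ≃L[ℝ] V') (D : BaseModel n ≃L[ℝ] BaseModel n)
    (P : V →L[ℝ] (BaseModel n →L[ℝ] ℝ) →L[ℝ] (BaseModel n [⋀^Fin (n + 1)]→L[ℝ] ℝ)) (w : V') :
    contractTop (R.arrowCongr ((D.arrowCongr (ContinuousLinearEquiv.refl ℝ ℝ)).arrowCongr
      D.continuousAlternatingMapCongrLeft) P) w =
      (contractTop P (R.symm w)).compContinuousLinearMap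
        (D.symm : BaseModel n →L[ℝ] BaseModel n) := by
  -- The bilinear map $(e,\alpha)\mapsto e\rfloor P(R^{-1}w,\alpha)$, whose trace is the contraction
  -- of $P$ at $R^{-1}w$.
  let b : BaseModel n →ₗ[ℝ] (BaseModel n →L[ℝ] ℝ) →ₗ[ℝ] (BaseModel n [⋀^Fin n]→L[ℝ] ℝ) :=
    LinearMap.mk₂ ℝ (fun e α => (P (R.symm w) α).curryLeft e)
      (by intros; simp) (by intros; simp) (by intros; simp) (by intros; simp)
  have h := BaseModel.sum_single_proj_equiv D.symm b
  rw [contractTop_apply, contractTop_apply,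
    ← ContinuousAlternatingMap.compContinuousLinearMapCLM_apply, map_sum]
  have h2 := congrArg (ContinuousAlternatingMap.compContinuousLinearMapCLM
    (D.symm : BaseModel n →L[ℝ] BaseModel n) :
      (BaseModel n [⋀^Fin n]→L[ℝ] ℝ) →L[ℝ] (BaseModel n [⋀^Fin n]→L[ℝ] ℝ)) h
  rw [map_sum, map_sum] at h2
  refine Eq.trans (Finset.sum_congr rfl fun l _ => ?_) h2
  exact ContinuousAlternatingMap.curryLeft_compContinuousLinearMap
    (P (R.symm w) ((EuclideanSpace.proj l : BaseModel n →L[ℝ] ℝ) ∘L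
      (D : BaseModel n →L[ℝ] BaseModel n))) (D.symm : BaseModel n →L[ℝ] BaseModel n) _

end TopForms

/-! ### The linear algebra of $p\,\omega + p^\lambda_i\,dy^i\wedge\omega_\lambda$ -/

section HomogeneousMomentum

variable {n : ℕ} {V : Type*} [NormedAddCommGroup V] [NormedSpace ℝ V]

/-- The form `ℓ + p^λ_i (dy^i - v^i_μ dx^μ) ∧ ω_λ` on `E × V`. -/
def cartanForm (ℓ : BaseModel n [⋀^Fin (n + 1)]→L[ℝ] ℝ)
    (P : V →L[ℝ] (BaseModel n →L[ℝ] ℝ) →L[ℝ] (BaseModel n [⋀^Fin (n + 1)]→L[ℝ] ℝ))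
    (v : BaseModel n →L[ℝ] V) : (BaseModel n × V) [⋀^Fin (n + 1)]→L[ℝ] ℝ :=
  ℓ.compContinuousLinearMap (ContinuousLinearMap.fst ℝ (BaseModel n) V) +
    ContinuousAlternatingMap.alternatizeUncurryFin
      (ContinuousAlternatingMap.compContinuousLinearMapCLM
          (ContinuousLinearMap.fst ℝ (BaseModel n) V) ∘L
        contractTop P ∘L (ContinuousLinearMap.snd ℝ (BaseModel n) V -
          v ∘L ContinuousLinearMap.fst ℝ (BaseModel n) V))

theorem alternatizeUncurryFin_compContinuousLinearMap {E E' : Type*} [NormedAddCommGroup E]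
    [NormedSpace ℝ E] [NormedAddCommGroup E'] [NormedSpace ℝ E'] {k : ℕ}
    (f : E →L[ℝ] E [⋀^Fin k]→L[ℝ] ℝ) (T : E' →L[ℝ] E) :
    (ContinuousAlternatingMap.alternatizeUncurryFin f).compContinuousLinearMap T =
      ContinuousAlternatingMap.alternatizeUncurryFin
        (ContinuousAlternatingMap.compContinuousLinearMapCLM T ∘L f ∘L T) := by
  ext v
  simp [ContinuousAlternatingMap.alternatizeUncurryFin_apply]
  rfl

/-- The part $-p^\lambda_i v^i_\mu\,dx^\mu\wedge\omega_\lambda$ is horizontal and equals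
$-p^\lambda_i v^i_\lambda\,\omega$, so it can be absorbed into $\ell$. Thus the form depends on
$\ell$ and $v$ only through $p=\ell-p^\lambda_i v^i_\lambda\,\omega$: this is the normal form with
coordinates $(p^\lambda_i,p)$. -/
theorem cartanForm_eq (ℓ : BaseModel n [⋀^Fin (n + 1)]→L[ℝ] ℝ)
    (P : V →L[ℝ] (BaseModel n →L[ℝ] ℝ) →L[ℝ] (BaseModel n [⋀^Fin (n + 1)]→L[ℝ] ℝ))
    (v : BaseModel n →L[ℝ] V) :
    cartanForm ℓ P v = cartanForm (ℓ - ∑ l, P (v (EuclideanSpace.single l 1))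
      (EuclideanSpace.proj l)) P 0 := by
  have h := congrArg (ContinuousAlternatingMap.compContinuousLinearMapCLM
    (ContinuousLinearMap.fst ℝ (BaseModel n) V) : (BaseModel n [⋀^Fin (n + 1)]→L[ℝ] ℝ) →L[ℝ]
      ((BaseModel n × V) [⋀^Fin (n + 1)]→L[ℝ] ℝ))
    (alternatizeUncurryFin_contractTop_comp P v)
  rw [ContinuousAlternatingMap.compContinuousLinearMapCLM_apply,
    alternatizeUncurryFin_compContinuousLinearMap] at h
  unfold cartanForm
  rw [← ContinuousAlternatingMap.compContinuousLinearMapCLM_apply,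
    ← ContinuousAlternatingMap.compContinuousLinearMapCLM_apply _ (ℓ - _), map_sub, ← h,
    ← ContinuousAlternatingMap.alternatizeUncurryFinCLM_apply,
    ← ContinuousAlternatingMap.alternatizeUncurryFinCLM_apply,
    ← ContinuousAlternatingMap.alternatizeUncurryFinCLM_apply]
  simp only [ContinuousLinearMap.comp_sub, map_sub, ContinuousLinearMap.zero_comp, sub_zero,
    ContinuousLinearMap.comp_assoc]
  abel

theorem eq_zero_of_contractTop_eq_zero
    {P : V →L[ℝ] (BaseModel n →L[ℝ] ℝ) →L[ℝ] (BaseModel n [⋀^Fin (n + 1)]→L[ℝ] ℝ)}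
    (h : contractTop P = 0) : P = 0 := by
  ext1 v
  ext1 α
  -- For the rank-one map $w=\alpha\otimes v$ the contraction $\sum_l P(\alpha(e_l)v, dx^l)$ is
  -- $P(v,\alpha)$, so the contracted momenta determine $P$.
  have h1 := alternatizeUncurryFin_contractTop_comp P (α.smulRight v)
  rw [h, ContinuousLinearMap.zero_comp,
    ← ContinuousAlternatingMap.alternatizeUncurryFinCLM_apply, map_zero] at h1
  conv_lhs => rw [← BaseModel.sum_smul_proj α]
  simpa using h1.symm

/-- The momenta are determined by the form `ℓ + p^λ_i (dy^i - v^i_μ dx^μ) ∧ ω_λ`. -/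
theorem exists_leftInverse_cartanForm [FiniteDimensional ℝ V] :
    ∃ s : (BaseModel n × V) [⋀^Fin (n + 1)]→L[ℝ] ℝ →L[ℝ]
      (V →L[ℝ] (BaseModel n →L[ℝ] ℝ) →L[ℝ] (BaseModel n [⋀^Fin (n + 1)]→L[ℝ] ℝ)),
      ∀ ℓ P v, s (cartanForm ℓ P v) = P := by
  have := finiteDimensional_alternating (E := BaseModel n) (k := n + 1)
  have := finiteDimensional_alternating (E := BaseModel n × V) (k := n + 1)
  let K : (BaseModel n [⋀^Fin (n + 1)]→L[ℝ] ℝ) ×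
      (V →L[ℝ] (BaseModel n →L[ℝ] ℝ) →L[ℝ] (BaseModel n [⋀^Fin (n + 1)]→L[ℝ] ℝ)) →ₗ[ℝ]
      (BaseModel n × V) [⋀^Fin (n + 1)]→L[ℝ] ℝ :=
    { toFun := fun p => cartanForm p.1 p.2 0
      map_add' := by
        intro p q
        ext v
        simp [cartanForm, contractTop_add, ContinuousAlternatingMap.alternatizeUncurryFin_apply]
        ring
      map_smul' := by
        intro c p
        ext v
        simp [cartanForm, contractTop_smul, ContinuousAlternatingMap.alternatizeUncurryFin_apply,
          Finset.mul_sum] }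
  have hK : Function.Injective K.toContinuousLinearMap := by
    rw [injective_iff_map_eq_zero]
    rintro ⟨ℓ, P⟩ h
    have h : cartanForm ℓ P 0 = 0 := h
    have hP : P = 0 := by
      apply eq_zero_of_contractTop_eq_zero
      ext1 w
      ext ξ
      -- On one vertical vector followed by horizontal ones, $\ell$ vanishes and only the term with
      -- $dy$ on the vertical vector survives; it is the contracted momentum.
      have h1 := congrArg (fun f => f (Matrix.vecCons ((0 : BaseModel n), w) fun i => (ξ i, 0))) h
      have h2 : (ℓ fun i => (Matrix.vecCons ((0 : BaseModel n), w) (fun i => (ξ i, 0)) i).1) = 0 :=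
        ℓ.map_coord_zero 0 rfl
      simpa [h2, cartanForm, ContinuousAlternatingMap.alternatizeUncurryFin_apply,
        Fin.sum_univ_succ, Function.comp_def, Fin.removeNth] using h1
    subst hP
    have hℓ : ℓ = 0 := by
      ext ξ
      have h1 := congrArg (fun f => f fun i => (ξ i, 0)) h
      simpa [cartanForm, ContinuousAlternatingMap.alternatizeUncurryFin_apply,
        Function.comp_def] using h1
    rw [hℓ]
    rfl
  obtain ⟨r, hr⟩ := ContinuousLinearMap.HasLeftInverse.of_injective_of_finiteDimensional hK
  refine ⟨ContinuousLinearMap.snd ℝ _ _ ∘L r, fun ℓ P v => ?_⟩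
  rw [cartanForm_eq]
  exact congrArg Prod.snd (hr (_, P))

end HomogeneousMomentum

/-! ### Smoothness for bundles described by fibre coordinates -/

namespace FibreBundle

variable {n : ℕ} {EY EF X Y F : Type*}
  [NormedAddCommGroup EY] [NormedSpace ℝ EY] [NormedAddCommGroup EF] [NormedSpace ℝ EF]
  [TopologicalSpace X] [ChartedSpace (BaseModel n) X]
  [TopologicalSpace Y] [ChartedSpace EY Y]
  [TopologicalSpace F] [ChartedSpace EF F]
  {B : FibreBundle n EY EF X Y F}

namespace FibreAtlas

variable {Fib : Y → Type*} {V : Type*} [NormedAddCommGroup V] [NormedSpace ℝ V]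
  [IsManifold 𝓘(ℝ, BaseModel n) ∞ X] [IsManifold 𝓘(ℝ, EF) ∞ F]
  (S : B.FibreAtlas Fib V) {EM M : Type*} [NormedAddCommGroup EM] [NormedSpace ℝ EM]
  [TopologicalSpace M] [ChartedSpace EM M]

theorem isOpen_chart_source (A : B.AdaptedChart) :
    IsOpen[S.core.toTopologicalSpace] (S.chart A).source :=
  S.core.open_source' (mem_range_self A)

theorem contMDiffOn_chart (A : B.AdaptedChart) :
    letI := S.core.toTopologicalSpace
    letI := S.core.toChartedSpace
    ContMDiffOn 𝓘(ℝ, (BaseModel n × EF) × V) 𝓘(ℝ, (BaseModel n × EF) × V) ∞ (S.chart A)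
      (S.chart A).source := by
  let _ := S.core.toTopologicalSpace
  let _ := S.core.toChartedSpace
  have := S.isManifold_core
  have h : S.core.openPartialHomeomorph (S.chart A) (mem_range_self A) ∈
      atlas ((BaseModel n × EF) × V) (Σ y, Fib y) :=
    mem_iUnion.2 ⟨_, mem_iUnion.2 ⟨mem_range_self A, mem_singleton _⟩⟩
  exact contMDiffOn_of_mem_maximalAtlas
    (IsManifold.subset_maximalAtlas (I := 𝓘(ℝ, (BaseModel n × EF) × V)) (n := ∞) h)

theorem contMDiffOn_chart_symm (A : B.AdaptedChart) :
    letI := S.core.toTopologicalSpace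
    letI := S.core.toChartedSpace
    ContMDiffOn 𝓘(ℝ, (BaseModel n × EF) × V) 𝓘(ℝ, (BaseModel n × EF) × V) ∞ (S.chart A).symm
      (S.chart A).target := by
  let _ := S.core.toTopologicalSpace
  let _ := S.core.toChartedSpace
  have := S.isManifold_core
  have h : S.core.openPartialHomeomorph (S.chart A) (mem_range_self A) ∈
      atlas ((BaseModel n × EF) × V) (Σ y, Fib y) :=
    mem_iUnion.2 ⟨_, mem_iUnion.2 ⟨mem_range_self A, mem_singleton _⟩⟩
  exact contMDiffOn_symm_of_mem_maximalAtlas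
    (IsManifold.subset_maximalAtlas (I := 𝓘(ℝ, (BaseModel n × EF) × V)) (n := ∞) h)

/-- The projection of a bundle with fibre coordinates is smooth. -/
theorem contMDiff_fst :
    letI := S.core.toTopologicalSpace
    letI := S.core.toChartedSpace
    ContMDiff 𝓘(ℝ, (BaseModel n × EF) × V) 𝓘(ℝ, EY) ∞ (fun p : Σ y, Fib y => p.1) := by
  let _ := S.core.toTopologicalSpace
  let _ := S.core.toChartedSpace
  intro p
  obtain ⟨A, hA⟩ := B.exists_adaptedChart p.1
  have h1 : ContMDiffOn 𝓘(ℝ, (BaseModel n × EF) × V) 𝓘(ℝ, BaseModel n × EF) ∞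
      (fun p => (S.chart A p).1) (S.chart A).source :=
    (contDiff_fst.contMDiff (E := (BaseModel n × EF) × V)).comp_contMDiffOn (S.contMDiffOn_chart A)
  have h2 := A.contMDiffOn_total_symm.comp h1 fun q hq => A.total.map_source hq
  refine (h2.congr fun q hq => ?_).contMDiffAt ((S.isOpen_chart_source A).mem_nhds hA)
  exact (A.total.left_inv hq).symm

/-- A map into a bundle with fibre coordinates is smooth if its projection and its fibre
coordinates are. -/
theorem contMDiffAt_of_fst_of_chart {f : M → Σ y, Fib y} {m : M} (A : B.AdaptedChart)
    (hm : (f m).1 ∈ A.total.source)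
    (h1 : ContMDiffAt 𝓘(ℝ, EM) 𝓘(ℝ, EY) ∞ (fun m => (f m).1) m)
    (h2 : ContMDiffAt 𝓘(ℝ, EM) 𝓘(ℝ, V) ∞ (fun m => (S.chart A (f m)).2) m) :
    letI := S.core.toTopologicalSpace
    letI := S.core.toChartedSpace
    ContMDiffAt 𝓘(ℝ, EM) 𝓘(ℝ, (BaseModel n × EF) × V) ∞ f m := by
  let _ := S.core.toTopologicalSpace
  let _ := S.core.toChartedSpace
  have h3 : ContMDiffAt 𝓘(ℝ, EM) 𝓘(ℝ, BaseModel n × EF) ∞ (fun m => A.total (f m).1) m :=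
    (A.contMDiffOn_total.contMDiffAt (A.total.open_source.mem_nhds hm)).comp m h1
  have h4 : ContMDiffAt 𝓘(ℝ, EM) 𝓘(ℝ, (BaseModel n × EF) × V) ∞
      (fun m => (A.total (f m).1, (S.chart A (f m)).2)) m := h3.prodMk_space h2
  have h5 : ContMDiffAt 𝓘(ℝ, (BaseModel n × EF) × V) 𝓘(ℝ, (BaseModel n × EF) × V) ∞
      (S.chart A).symm (A.total (f m).1, (S.chart A (f m)).2) := by
    refine (S.contMDiffOn_chart_symm A).contMDiffAt (IsOpen.mem_nhds ?_ ?_)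
    · exact A.total.open_target.prod isOpen_univ
    · exact ⟨A.total.map_source hm, mem_univ _⟩
  refine (h5.comp m h4).congr_of_eventuallyEq ?_
  filter_upwards [h1.continuousAt (A.total.open_source.mem_nhds hm)] with m' hm'
  exact ((S.chart A).left_inv hm').symm

theorem contMDiffAt_chart_comp {f : M → Σ y, Fib y} {m : M} (A : B.AdaptedChart)
    (hm : (f m).1 ∈ A.total.source)
    (hf : letI := S.core.toTopologicalSpace
      letI := S.core.toChartedSpace
      ContMDiffAt 𝓘(ℝ, EM) 𝓘(ℝ, (BaseModel n × EF) × V) ∞ f m) :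
    ContMDiffAt 𝓘(ℝ, EM) 𝓘(ℝ, (BaseModel n × EF) × V) ∞ (fun m => S.chart A (f m)) m := by
  let _ := S.core.toTopologicalSpace
  let _ := S.core.toChartedSpace
  have h : ContMDiffAt 𝓘(ℝ, (BaseModel n × EF) × V) 𝓘(ℝ, (BaseModel n × EF) × V) ∞ (S.chart A)
      (f m) := (S.contMDiffOn_chart A).contMDiffAt ((S.isOpen_chart_source A).mem_nhds hm)
  exact h.comp m hf

end FibreAtlas

end FibreBundle

/-! ### Smooth dependence of top-degree forms and Cartan forms on parameters -/

section TopForms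

variable {n : ℕ} {P : Type*} [NormedAddCommGroup P] [NormedSpace ℝ P]

theorem eq_zero_of_apply_single_eq_zero {Ω : BaseModel n [⋀^Fin (n + 1)]→L[ℝ] ℝ}
    (h : Ω (fun l => EuclideanSpace.single l 1) = 0) : Ω = 0 := by
  have h1 := Ω.toAlternatingMap.eq_smul_basis_det (EuclideanSpace.basisFun _ ℝ).toBasis
  have h2 : Ω.toAlternatingMap (EuclideanSpace.basisFun (Fin (n + 1)) ℝ).toBasis = 0 := by
    rw [← h]
    simp only [OrthonormalBasis.coe_toBasis]
    exact congrArg Ω (funext fun l => EuclideanSpace.basisFun_apply _ _ l)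
  rw [h2, zero_smul] at h1
  ext v
  exact congrArg (fun f => f v) h1

/-- A form of top degree depends smoothly on parameters if its component does. -/
theorem contDiffOn_of_apply_single {s : Set P} {Ω : P → BaseModel n [⋀^Fin (n + 1)]→L[ℝ] ℝ}
    (h : ContDiffOn ℝ ∞ (fun p => Ω p (fun l => EuclideanSpace.single l 1)) s) :
    ContDiffOn ℝ ∞ Ω s := by
  have := finiteDimensional_alternating (E := BaseModel n) (k := n + 1)
  let ev : (BaseModel n [⋀^Fin (n + 1)]→L[ℝ] ℝ) →ₗ[ℝ] ℝ :=
    { toFun := fun Ω => Ω fun l => EuclideanSpace.single l 1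
      map_add' := fun _ _ => rfl
      map_smul' := fun _ _ => rfl }
  have hinj : Function.Injective ev.toContinuousLinearMap := by
    rw [injective_iff_map_eq_zero]
    exact fun Ω hΩ => eq_zero_of_apply_single_eq_zero hΩ
  -- A top-degree form is recovered from its value on the standard basis by a fixed linear map,
  -- which carries smoothness of the component over to the form.
  obtain ⟨r, hr⟩ := ContinuousLinearMap.HasLeftInverse.of_injective_of_finiteDimensional hinj
  exact (r.contDiff.comp_contDiffOn h).congr fun p _ => (hr (Ω p)).symm

theorem contDiffOn_cartanForm {V : Type*} [NormedAddCommGroup V] [NormedSpace ℝ V]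
    [FiniteDimensional ℝ V] {s : Set P} {ℓ : P → BaseModel n [⋀^Fin (n + 1)]→L[ℝ] ℝ}
    {p : P → V →L[ℝ] (BaseModel n →L[ℝ] ℝ) →L[ℝ] (BaseModel n [⋀^Fin (n + 1)]→L[ℝ] ℝ)}
    {v : P → BaseModel n →L[ℝ] V} (hℓ : ContDiffOn ℝ ∞ ℓ s) (hp : ContDiffOn ℝ ∞ p s)
    (hv : ContDiffOn ℝ ∞ v s) : ContDiffOn ℝ ∞ (fun x => cartanForm (ℓ x) (p x) (v x)) s := by
  have := finiteDimensional_alternating (E := BaseModel n) (k := n + 1)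
  let C : (V →L[ℝ] (BaseModel n →L[ℝ] ℝ) →L[ℝ] (BaseModel n [⋀^Fin (n + 1)]→L[ℝ] ℝ)) →ₗ[ℝ]
      V →L[ℝ] (BaseModel n [⋀^Fin n]→L[ℝ] ℝ) :=
    { toFun := contractTop, map_add' := contractTop_add, map_smul' := contractTop_smul }
  have h1 : ContDiffOn ℝ ∞ (fun x => contractTop (p x)) s :=
    C.toContinuousLinearMap.contDiff.comp_contDiffOn hp
  have h2 : ContDiffOn ℝ ∞ (fun x => ContinuousAlternatingMap.compContinuousLinearMapCLM
      (ContinuousLinearMap.fst ℝ (BaseModel n) V) (ℓ x)) s :=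
    (ContinuousLinearMap.contDiff _).comp_contDiffOn hℓ
  let T : (BaseModel n [⋀^Fin n]→L[ℝ] ℝ) →L[ℝ] ((BaseModel n × V) [⋀^Fin n]→L[ℝ] ℝ) :=
    ContinuousAlternatingMap.compContinuousLinearMapCLM (ContinuousLinearMap.fst ℝ (BaseModel n) V)
  have h3 : ContDiffOn ℝ ∞ (fun x => T ∘L contractTop (p x) ∘L
        (ContinuousLinearMap.snd ℝ (BaseModel n) V -
          v x ∘L ContinuousLinearMap.fst ℝ (BaseModel n) V)) s :=
    contDiffOn_const.clm_comp (h1.clm_comp (contDiffOn_const.sub (hv.clm_comp contDiffOn_const)))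
  exact h2.add ((ContinuousLinearMap.contDiff (ContinuousAlternatingMap.alternatizeUncurryFinCLM
    (n := n) ℝ (BaseModel n × V) ℝ)).comp_contDiffOn h3)

end TopForms

/-! ### $L$, $\widehat L$ and $\widehat H_L$ in fibred coordinates -/

namespace FibreBundle

variable {n : ℕ} {EY EF X Y F : Type*}
  [NormedAddCommGroup EY] [NormedSpace ℝ EY] [NormedAddCommGroup EF] [NormedSpace ℝ EF]
  [TopologicalSpace X] [ChartedSpace (BaseModel n) X]
  [TopologicalSpace Y] [ChartedSpace EY Y]
  [TopologicalSpace F] [ChartedSpace EF F]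
  {B : FibreBundle n EY EF X Y F}
  [IsManifold 𝓘(ℝ, BaseModel n) ∞ X] [IsManifold 𝓘(ℝ, EF) ∞ F]

namespace Lagrangian

variable (L : B.Lagrangian) (A : B.AdaptedChart)

/-- The expression `𝓛(x^λ, y^i, y^i_λ) ω` of the Lagrangian in fibred coordinates. -/
def coordLagrangian (q : JetModel n EF) : BaseModel n [⋀^Fin (n + 1)]→L[ℝ] ℝ :=
  (L.toFun ((B.jetAtlas.chart A).symm q)).compContinuousLinearMap
    (tangentMapAt (BaseModel n) (BaseModel n) A.base.symm
      (A.base (B.proj ((B.jetAtlas.chart A).symm q).1)))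

theorem coordLagrangian_chart (j : B.Jet) (hj : j.pt ∈ A.total.source) :
    L.coordLagrangian A (B.jetAtlas.chart A j) = (L.toFun j).compContinuousLinearMap
      ((A.dBase hj).symm : BaseModel n →L[ℝ] BaseModel n) := by
  unfold coordLagrangian
  rw [(B.jetAtlas.chart A).left_inv hj]
  rfl

theorem contDiffOn_coordLagrangian :
    ContDiffOn ℝ ∞ (L.coordLagrangian A) (A.total.target ×ˢ univ) := by
  apply contDiffOn_of_apply_single
  rw [← contMDiffOn_iff_contDiffOn]
  exact (L.smooth A).comp (B.jetAtlas.contMDiffOn_chart_symm A)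
    fun q hq => A.total.map_target hq.1

theorem differentiableAt_coordLagrangian (j : B.Jet) (hj : j.pt ∈ A.total.source) :
    DifferentiableAt ℝ (L.coordLagrangian A) (B.jetAtlas.chart A j) := by
  refine ((L.contDiffOn_coordLagrangian A).contDiffAt (IsOpen.mem_nhds ?_ ?_)).differentiableAt
    (by simp)
  · exact A.total.open_target.prod isOpen_univ
  · exact (B.jetAtlas.chart A).map_source hj

/-- The momenta `∂𝓛/∂y^i_λ` in fibred coordinates. -/
def coordMomentum (q : JetModel n EF) :
    EF →L[ℝ] (BaseModel n →L[ℝ] ℝ) →L[ℝ] (BaseModel n [⋀^Fin (n + 1)]→L[ℝ] ℝ) :=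
  (ContinuousLinearMap.compL ℝ (BaseModel n →L[ℝ] ℝ) (BaseModel n →L[ℝ] EF)
    (BaseModel n [⋀^Fin (n + 1)]→L[ℝ] ℝ) (fderiv ℝ (L.coordLagrangian A) q ∘L
      ContinuousLinearMap.inr ℝ (BaseModel n × EF) (BaseModel n →L[ℝ] EF))) ∘L
    (ContinuousLinearMap.smulRightL ℝ (BaseModel n) EF).flip

theorem coordMomentum_apply (q : JetModel n EF) (w : EF) (α : BaseModel n →L[ℝ] ℝ) :
    L.coordMomentum A q w α = fderiv ℝ (L.coordLagrangian A) q (0, α.smulRight w) := rfl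

/-- With $u=\sum_l dx^l\otimes u(e_l)$, linearity of the derivative gives $\pi^\lambda_i
u^i_\lambda=(\partial\mathcal L/\partial y^i_\lambda)\,u^i_\lambda$. This is what cancels when
$\mathcal L-\pi^\lambda_i y^i_\lambda$ is differentiated along a fibre of $\widehat L$. -/
theorem sum_coordMomentum (q : JetModel n EF) (u : BaseModel n →L[ℝ] EF) :
    ∑ l, L.coordMomentum A q (u (EuclideanSpace.single l 1)) (EuclideanSpace.proj l) =
      fderiv ℝ (L.coordLagrangian A) q (0, u) := by
  simp only [coordMomentum_apply]
  rw [← map_sum]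
  congr 1
  refine Prod.ext (by simp [Prod.fst_sum]) ?_
  simp only [Prod.snd_sum]
  ext1 ξ
  conv_rhs => rw [← BaseModel.sum_apply_smul_single ξ]
  simp [sum_apply]

theorem contDiffOn_coordMomentum :
    ContDiffOn ℝ ∞ (L.coordMomentum A) (A.total.target ×ˢ univ) := by
  have h : ContDiffOn ℝ ∞ (fderiv ℝ (L.coordLagrangian A)) (A.total.target ×ˢ univ) :=
    (L.contDiffOn_coordLagrangian A).fderiv_of_isOpen (A.total.open_target.prod isOpen_univ)
      (by simp)
  exact ((ContinuousLinearMap.contDiff _).comp_contDiffOn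
    (h.clm_comp contDiffOn_const)).clm_comp contDiffOn_const

variable {A}

/-- Jet coordinates are affine on the fibres of $J^1Y\to Y$: adding $u$ to a jet adds the linear
expression `c u` to its coordinates. The intrinsic fibre derivative is therefore the coordinate
derivative in the $y^i_\lambda$ directions, by the chain rule. -/
theorem fibreDeriv_apply (j : B.Jet) (hj : j.pt ∈ A.total.source)
    (u : BaseModel n →L[ℝ] B.vert j.pt) :
    L.fibreDeriv j u = (fderiv ℝ (L.coordLagrangian A) (B.jetAtlas.chart A j)
      (0, (A.dVert hj : B.vert j.pt →L[ℝ] EF) ∘L u ∘L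
        ((A.dBase hj).symm : BaseModel n →L[ℝ] BaseModel n))).compContinuousLinearMap
      (A.dBase hj : BaseModel n →L[ℝ] BaseModel n) := by
  let c : (BaseModel n →L[ℝ] B.vert j.pt) →L[ℝ] JetModel n EF :=
    ContinuousLinearMap.inr ℝ (BaseModel n × EF) (BaseModel n →L[ℝ] EF) ∘L
      ((ContinuousLinearMap.compL ℝ (BaseModel n) (B.vert j.pt) EF
        (A.dVert hj : B.vert j.pt →L[ℝ] EF)) ∘L
      ((ContinuousLinearMap.compL ℝ (BaseModel n) (BaseModel n) (B.vert j.pt)).flip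
        ((A.dBase hj).symm : BaseModel n →L[ℝ] BaseModel n)))
  let pb : (BaseModel n [⋀^Fin (n + 1)]→L[ℝ] ℝ) →L[ℝ] (BaseModel n [⋀^Fin (n + 1)]→L[ℝ] ℝ) :=
    ContinuousAlternatingMap.compContinuousLinearMapCLM
      (A.dBase hj : BaseModel n →L[ℝ] BaseModel n)
  have hc : ∀ u, B.jetAtlas.chart A (j.addVert u) = B.jetAtlas.chart A j + c u := by
    intro u
    rw [B.jetAtlas.chart_apply A j hj, B.jetAtlas.chart_apply A (j.addVert u) hj]
    refine Prod.ext (add_zero _).symm ?_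
    ext1 ξ
    exact congrArg Prod.snd ((A.dTotal hj).map_add (j.lin ((A.dBase hj).symm ξ))
      (u ((A.dBase hj).symm ξ) : EY))
  have hL : (fun u => L.toFun (j.addVert u)) =
      fun u => pb (L.coordLagrangian A (B.jetAtlas.chart A j + c u)) := by
    funext u
    rw [← hc u, L.coordLagrangian_chart A (j.addVert u) hj]
    ext v
    exact congrArg (L.toFun (j.addVert u))
      (funext fun i => ((A.dBase hj).symm_apply_apply (v i)).symm)
  have h0 : HasFDerivAt (fun u => B.jetAtlas.chart A j + c u) c 0 := c.hasFDerivAt.const_add _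
  have h1 : HasFDerivAt (L.coordLagrangian A)
      (fderiv ℝ (L.coordLagrangian A) (B.jetAtlas.chart A j)) (B.jetAtlas.chart A j + c 0) := by
    rw [map_zero, add_zero]
    exact (L.differentiableAt_coordLagrangian A j hj).hasFDerivAt
  have h2 := (pb.hasFDerivAt.comp 0
    (HasFDerivAt.comp (f := fun u => B.jetAtlas.chart A j + c u) 0 h1 h0)).fderiv
  unfold fibreDeriv
  rw [hL]
  exact congrArg (fun l => l u) h2

variable [FiniteDimensional ℝ EF]

theorem legendreAtlas_coord_momentum (j : B.Jet) (hj : j.pt ∈ A.total.source) :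
    B.legendreAtlas.coord A hj (L.momentum j) =
      L.coordMomentum A (B.jetAtlas.chart A j) := by
  ext1 w
  ext1 α
  rw [coordMomentum_apply]
  -- This increment of the jet is chosen so that its coordinate expression is $\alpha\otimes w$.
  have h := L.fibreDeriv_apply j hj ((α ∘L (A.dBase hj : BaseModel n →L[ℝ] BaseModel n)).smulRight
    ((A.dVert hj).symm w))
  have h2 : (A.dVert hj : B.vert j.pt →L[ℝ] EF) ∘L
      ((α ∘L (A.dBase hj : BaseModel n →L[ℝ] BaseModel n)).smulRight
        ((A.dVert hj).symm w)) ∘L ((A.dBase hj).symm : BaseModel n →L[ℝ] BaseModel n) =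
      α.smulRight w := by
    ext ξ
    simp
  rw [h2] at h
  ext v
  have h3 := congrArg (fun f => f fun i => (A.dBase hj).symm (v i)) h
  refine Eq.trans h3 ?_
  simp [Function.comp_def]

theorem legendreAtlas_chart_legendre (j : B.Jet) (hj : j.pt ∈ A.total.source) :
    (B.legendreAtlas.chart A (L.legendre j)).2 = L.coordMomentum A (B.jetAtlas.chart A j) := by
  rw [← L.legendreAtlas_coord_momentum j hj, B.legendreAtlas.chart_apply A (L.legendre j) hj]
  rfl

/-- Each ingredient of $H_L$ has its expected coordinate form: $T\pi$ is the first projection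
(`h1`), the contact form is $dy-y_\lambda dx^\lambda$ (`h2`), and the contracted momenta transform
by pull-back (`h4`). All later arguments about $\widehat H_L$ go through this formula. -/
theorem homLegendreAtlas_chart_homLegendre (j : B.Jet) (hj : j.pt ∈ A.total.source) :
    ((B.homLegendreAtlas.chart A (L.homLegendre j)).2 :
        (BaseModel n × EF) [⋀^Fin (n + 1)]→L[ℝ] ℝ) =
      cartanForm (L.coordLagrangian A (B.jetAtlas.chart A j))
        (L.coordMomentum A (B.jetAtlas.chart A j)) (B.jetAtlas.chart A j).2 := by
  rw [B.homLegendreAtlas.chart_apply A (L.homLegendre j) hj]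
  have h1 : B.dproj j.pt ∘L ((A.dTotal hj).symm : BaseModel n × EF →L[ℝ] EY) =
      ((A.dBase hj).symm : BaseModel n →L[ℝ] BaseModel n) ∘L
        ContinuousLinearMap.fst ℝ (BaseModel n) EF := by
    refine ContinuousLinearMap.ext fun w => ?_
    exact A.dproj_dTotal_symm hj w
  have h2 : j.contact ∘L ((A.dTotal hj).symm : BaseModel n × EF →L[ℝ] EY) =
      ((A.dVert hj).symm : EF →L[ℝ] B.vert j.pt) ∘L (ContinuousLinearMap.snd ℝ (BaseModel n) EF -
        (B.jetAtlas.chart A j).2 ∘L ContinuousLinearMap.fst ℝ (BaseModel n) EF) := by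
    refine ContinuousLinearMap.ext fun w => ?_
    apply (A.dVert hj).injective
    have h3 : A.dVert hj (j.contact ((A.dTotal hj).symm w)) =
        (A.dTotal hj ((A.dTotal hj).symm w - j.lin (B.dproj j.pt ((A.dTotal hj).symm w)))).2 := rfl
    rw [B.jetAtlas.chart_apply A j hj]
    refine h3.trans ?_
    rw [map_sub, A.dproj_dTotal_symm hj]
    simp
    rfl
  have h4 : ∀ w, contractTop (L.coordMomentum A (B.jetAtlas.chart A j)) w =
      (contractTop (L.momentum j) ((A.dVert hj).symm w)).compContinuousLinearMap
        ((A.dBase hj).symm : BaseModel n →L[ℝ] BaseModel n) := by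
    intro w
    rw [← L.legendreAtlas_coord_momentum j hj]
    exact contractTop_arrowCongr (A.dVert hj) (A.dBase hj) (L.momentum j) w
  have h5 : (L.poincareCartanAt j).compContinuousLinearMap
      ((A.dTotal hj).symm : BaseModel n × EF →L[ℝ] EY) =
      cartanForm (L.coordLagrangian A (B.jetAtlas.chart A j))
        (L.coordMomentum A (B.jetAtlas.chart A j)) (B.jetAtlas.chart A j).2 := by
    unfold poincareCartanAt cartanForm
    rw [← ContinuousAlternatingMap.compContinuousLinearMapCLM_apply, map_add,
      ContinuousAlternatingMap.compContinuousLinearMapCLM_apply,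
      ContinuousAlternatingMap.compContinuousLinearMapCLM_apply,
      alternatizeUncurryFin_compContinuousLinearMap]
    congr 1
    · rw [L.coordLagrangian_chart A j hj]
      ext v
      exact congrArg (L.toFun j) (funext fun i => congrArg (fun l => l (v i)) h1)
    · congr 1
      refine ContinuousLinearMap.ext fun w => ?_
      ext v
      have h6 := congrArg (fun l => l w) h2
      have h7 := h4 ((ContinuousLinearMap.snd ℝ (BaseModel n) EF -
        (B.jetAtlas.chart A j).2 ∘L ContinuousLinearMap.fst ℝ (BaseModel n) EF) w)
      refine Eq.trans ?_ (congrArg (fun f => f fun i => (v i).1) h7).symm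
      refine Eq.trans ?_ (congrArg (fun u => contractTop (L.momentum j) u
        fun i => (A.dBase hj).symm (v i).1) h6)
      exact congrArg (contractTop (L.momentum j) (j.contact ((A.dTotal hj).symm w)))
        (funext fun i => congrArg (fun l => l (v i)) h1)
  exact h5

/-- The Legendre morphism `Ĥ_L : J¹Y → Z_Y` is smooth. -/
theorem contMDiff_homLegendre :
    ContMDiff 𝓘(ℝ, JetModel n EF) 𝓘(ℝ, HomLegendreModel n EF) ∞ L.homLegendre := by
  intro j
  obtain ⟨A, hA⟩ := B.exists_adaptedChart j.pt
  have := finiteDimensional_alternating (E := BaseModel n × EF) (k := n + 1)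
  let ι := (formsVanishingOnTwo
    (ContinuousLinearMap.fst ℝ (BaseModel n) EF).ker (n + 1)).subtypeL
  have hinj : Function.Injective ι := Subtype.val_injective
  -- The fibre coordinate lies in a subspace of the alternating forms. A linear retraction onto it
  -- turns smoothness in the ambient space into smoothness in the subspace.
  obtain ⟨r, hr⟩ := ContinuousLinearMap.HasLeftInverse.of_injective_of_finiteDimensional hinj
  have hC : ContDiffOn ℝ ∞ (fun q : JetModel n EF => r (cartanForm (L.coordLagrangian A q)
      (L.coordMomentum A q) q.2)) (A.total.target ×ˢ univ) :=
    r.contDiff.comp_contDiffOn (contDiffOn_cartanForm (L.contDiffOn_coordLagrangian A)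
      (L.contDiffOn_coordMomentum A) contDiffOn_snd)
  have hO : IsOpen {i : B.Jet | i.pt ∈ A.total.source} := B.jetAtlas.isOpen_chart_source A
  have h2 : ContMDiffOn 𝓘(ℝ, JetModel n EF) 𝓘(ℝ, JetModel n EF) ∞
      (fun i : B.Jet => B.jetAtlas.chart A i) {i : B.Jet | i.pt ∈ A.total.source} :=
    B.jetAtlas.contMDiffOn_chart A
  have h3 := hC.contMDiffOn.comp h2 fun q hq => (B.jetAtlas.chart A).map_source hq
  have h4 : ContMDiff 𝓘(ℝ, JetModel n EF) 𝓘(ℝ, EY) ∞ (fun i : B.Jet => (L.homLegendre i).1) :=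
    B.jetAtlas.contMDiff_fst
  refine B.homLegendreAtlas.contMDiffAt_of_fst_of_chart A hA h4.contMDiffAt
    ((h3.congr fun i hi => ?_).contMDiffAt (hO.mem_nhds hA))
  rw [Function.comp_apply, ← L.homLegendreAtlas_chart_homLegendre i hi]
  exact (hr _).symm

end Lagrangian

end FibreBundle

/-! ### Curves in the fibres of a submersion -/

section Submersion

universe u

variable {E : Type u} {M E' M' : Type*}
  [NormedAddCommGroup E] [NormedSpace ℝ E] [TopologicalSpace M] [ChartedSpace E M]
  [NormedAddCommGroup E'] [NormedSpace ℝ E'] [TopologicalSpace M'] [ChartedSpace E' M']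

/-- Nearby points in a fibre of a submersion are connected by a smooth curve in the fibre. -/
theorem Manifold.IsSubmersionAt.exists_curve_in_fibre [IsManifold 𝓘(ℝ, E) ∞ M] {f : M → M'}
    {m : M}
    (h : IsSubmersionAt 𝓘(ℝ, E) 𝓘(ℝ, E') ∞ f m) :
    ∀ᶠ m' in 𝓝 m, f m' = f m → ∃ (O : Set ℝ) (γ : ℝ → M), IsOpen O ∧ IsPreconnected O ∧
      0 ∈ O ∧ 1 ∈ O ∧ ContMDiffOn 𝓘(ℝ) 𝓘(ℝ, E) ∞ γ O ∧ γ 0 = m ∧ γ 1 = m' ∧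
      ∀ t ∈ O, f (γ t) = f m := by
  set d := h.domChart with hd
  set c := h.codChart with hc
  have hm : m ∈ d.source := h.mem_domChart_source
  obtain ⟨ε, hε, hball⟩ := Metric.isOpen_iff.1 d.open_target (d m) (d.map_source hm)
  -- The normal form of a submersion: in suitable charts $f$ is a linear projection. Its fibres are
  -- affine in the chart, so the segment from $m$ to $m'$ stays in the fibre.
  have hwr : ∀ x ∈ d.target, c (f (d.symm x)) = (h.equiv x).1 := fun x hx =>
    h.writtenInCharts (show x ∈ (h.domChart.extend 𝓘(ℝ, E)).target by simpa using hx)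
  have hsrc : ∀ x ∈ d.source, f x ∈ c.source := fun x hx => h.source_subset_preimage_source hx
  filter_upwards [d.open_source.mem_nhds hm,
    (d.continuousAt hm).preimage_mem_nhds (Metric.ball_mem_nhds _ hε)] with m' hm' hmb hfm
  let l : ℝ →ᴬ[ℝ] E := ContinuousAffineMap.lineMap (d m) (d m')
  have hl : ∀ t, l t = AffineMap.lineMap (d m) (d m') t := fun t => rfl
  -- The parameter set is the preimage of a ball under an affine map: open, convex, and containing
  -- $0$ and $1$. Having it open avoids one-sided derivatives at the ends.
  refine ⟨l ⁻¹' Metric.ball (d m) ε, fun t => d.symm (l t), Metric.isOpen_ball.preimage l.continuous,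
    ((convex_ball (d m) ε).affine_preimage (l : ℝ →ᵃ[ℝ] E)).isPreconnected, ?_, ?_, ?_, ?_, ?_, ?_⟩
  · simpa [hl] using hε
  · simpa [hl] using hmb
  · have h1 : ContMDiffOn 𝓘(ℝ, E) 𝓘(ℝ, E) ∞ d.symm d.target :=
      contMDiffOn_symm_of_mem_maximalAtlas h.domChart_mem_maximalAtlas
    exact h1.comp l.contDiff.contMDiff.contMDiffOn fun t ht => hball ht
  · simp [hl, d.left_inv hm]
  · simp [hl, d.left_inv hm']
  · intro t ht
    have ht' : l t ∈ d.target := hball ht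
    refine c.injOn (hsrc _ (d.map_target ht')) (hsrc _ hm) ?_
    have h1 : (h.equiv (d m)).1 = c (f m) := by
      rw [← hwr _ (d.map_source hm), d.left_inv hm]
    have h2 : (h.equiv (d m')).1 = c (f m) := by
      rw [← hwr _ (d.map_source hm'), d.left_inv hm', hfm]
    rw [hwr _ ht', hl, AffineMap.lineMap_apply_module']
    simp [h1, h2]

end Submersion

/-! ### $\widehat H_L$ and $\widehat L$ have the same fibres -/

namespace FibreBundle

variable {n : ℕ} {EY EF X Y F : Type*}
  [NormedAddCommGroup EY] [NormedSpace ℝ EY] [NormedAddCommGroup EF] [NormedSpace ℝ EF]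
  [TopologicalSpace X] [ChartedSpace (BaseModel n) X]
  [TopologicalSpace Y] [ChartedSpace EY Y]
  [TopologicalSpace F] [ChartedSpace EF F]
  {B : FibreBundle n EY EF X Y F}
  [IsManifold 𝓘(ℝ, BaseModel n) ∞ X] [IsManifold 𝓘(ℝ, EF) ∞ F]
  [FiniteDimensional ℝ EF]

namespace Lagrangian

variable (L : B.Lagrangian)

theorem homLegendre_eq_of_chart {A : B.AdaptedChart} {j j' : B.Jet} (hj : j.pt ∈ A.total.source)
    (hj' : j'.pt ∈ A.total.source) (hpt : j.pt = j'.pt)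
    (h : cartanForm (L.coordLagrangian A (B.jetAtlas.chart A j))
        (L.coordMomentum A (B.jetAtlas.chart A j)) (B.jetAtlas.chart A j).2 =
      cartanForm (L.coordLagrangian A (B.jetAtlas.chart A j'))
        (L.coordMomentum A (B.jetAtlas.chart A j')) (B.jetAtlas.chart A j').2) :
    L.homLegendre j = L.homLegendre j' := by
  rw [← L.homLegendreAtlas_chart_homLegendre j hj, ← L.homLegendreAtlas_chart_homLegendre j' hj']
    at h
  refine (B.homLegendreAtlas.chart A).injOn hj hj' (Prod.ext ?_ (Subtype.ext h))
  exact congrArg A.total hpt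

theorem legendre_eq_of_chart {A : B.AdaptedChart} {j j' : B.Jet} (hj : j.pt ∈ A.total.source)
    (hj' : j'.pt ∈ A.total.source) (hpt : j.pt = j'.pt)
    (h : L.coordMomentum A (B.jetAtlas.chart A j) = L.coordMomentum A (B.jetAtlas.chart A j')) :
    L.legendre j = L.legendre j' := by
  rw [← L.legendreAtlas_chart_legendre j hj, ← L.legendreAtlas_chart_legendre j' hj'] at h
  refine (B.legendreAtlas.chart A).injOn hj hj' (Prod.ext ?_ h)
  exact congrArg A.total hpt

/-- The Legendre map factors through the Legendre morphism to `Z_Y`. -/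
theorem legendre_eq_of_homLegendre_eq {j j' : B.Jet} (h : L.homLegendre j = L.homLegendre j') :
    L.legendre j = L.legendre j' := by
  have hpt : j.pt = j'.pt := congrArg (fun z : B.HomLegendre => z.pt) h
  obtain ⟨A, hA⟩ := B.exists_adaptedChart j.pt
  have hA' : j'.pt ∈ A.total.source := hpt ▸ hA
  -- `s` extracts the momenta from the coordinate expression of $\widehat H_L(j)$.
  obtain ⟨s, hs⟩ := exists_leftInverse_cartanForm (n := n) (V := EF)
  refine L.legendre_eq_of_chart hA hA' hpt ?_
  rw [← hs (L.coordLagrangian A (B.jetAtlas.chart A j))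
      (L.coordMomentum A (B.jetAtlas.chart A j)) (B.jetAtlas.chart A j).2,
    ← L.homLegendreAtlas_chart_homLegendre j hA, h, L.homLegendreAtlas_chart_homLegendre j' hA', hs]

/-- The Legendre morphism to `Z_Y` is constant along curves on which the Legendre map is. -/
theorem homLegendre_eq_of_curve {O : Set ℝ} {γ : ℝ → B.Jet} (hO : IsOpen O)
    (hO' : IsPreconnected O) (hγ : ContMDiffOn 𝓘(ℝ) 𝓘(ℝ, JetModel n EF) ∞ γ O) {q : B.Legendre}
    (hq : ∀ t ∈ O, L.legendre (γ t) = q) {a b : ℝ} (ha : a ∈ O) (hb : b ∈ O) :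
    L.homLegendre (γ a) = L.homLegendre (γ b) := by
  have hpt : ∀ t ∈ O, (γ t).pt = q.pt := fun t ht =>
    congrArg (fun z : B.Legendre => z.pt) (hq t ht)
  obtain ⟨A, hA⟩ := B.exists_adaptedChart q.pt
  have hAt : ∀ t ∈ O, (γ t).pt ∈ A.total.source := fun t ht => (hpt t ht).symm ▸ hA
  set c : ℝ → JetModel n EF := fun t => B.jetAtlas.chart A (γ t) with hc
  set P := (B.legendreAtlas.chart A q).2 with hP
  have hcP : ∀ t ∈ O, L.coordMomentum A (c t) = P := by
    intro t ht
    rw [← L.legendreAtlas_chart_legendre (γ t) (hAt t ht), hq t ht]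
  have hc1 : ∀ t ∈ O, (c t).1 = A.total q.pt := fun t ht => congrArg A.total (hpt t ht)
  have hcd : ∀ t ∈ O, DifferentiableAt ℝ c t := by
    intro t ht
    have h : ContMDiffAt 𝓘(ℝ) 𝓘(ℝ, JetModel n EF) ∞ c t :=
      B.jetAtlas.contMDiffAt_chart_comp A (hAt t ht) (hγ.contMDiffAt (hO.mem_nhds ht))
    exact (contMDiffAt_iff_contDiffAt.1 h).differentiableAt (by simp)
  -- The pairing $u\mapsto p^\lambda_i u^i_\lambda\,\omega$ with the momenta `P`, which are the same
  -- along the whole curve; hence `σ` is one fixed linear map.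
  let σ : (BaseModel n →L[ℝ] EF) →L[ℝ] (BaseModel n [⋀^Fin (n + 1)]→L[ℝ] ℝ) :=
    ∑ l, (ContinuousLinearMap.apply ℝ _ (EuclideanSpace.proj l) ∘L P) ∘L
      (ContinuousLinearMap.apply ℝ EF (EuclideanSpace.single l (1 : ℝ) : BaseModel n))
  have hσ : ∀ u, σ u = ∑ l, P (u (EuclideanSpace.single l 1)) (EuclideanSpace.proj l) := by
    intro u
    simp [σ, sum_apply]
  -- The coordinate $p=\mathcal L-\pi^\lambda_i y^i_\lambda$ is stationary: $(x,y)$ does not move,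
  -- and the derivative of $\mathcal L$ along $\dot y^i_\lambda$ is $\pi^\lambda_i\dot y^i_\lambda$.
  have hder : ∀ t ∈ O, HasDerivAt (fun t => L.coordLagrangian A (c t) - σ (c t).2) 0 t := by
    intro t ht
    have h1 := (hcd t ht).hasDerivAt
    have h2 : HasDerivAt (fun t => (c t).1) (deriv c t).1 t :=
      (ContinuousLinearMap.fst ℝ (BaseModel n × EF)
        (BaseModel n →L[ℝ] EF)).hasFDerivAt.comp_hasDerivAt t h1
    have h3 : (deriv c t).1 = 0 := by
      refine h2.unique ((hasDerivAt_const t (A.total q.pt)).congr_of_eventuallyEq ?_)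
      filter_upwards [hO.mem_nhds ht] with s hs using hc1 s hs
    have h4 : HasDerivAt (fun t => σ (c t).2) (σ (deriv c t).2) t :=
      (σ ∘L ContinuousLinearMap.snd ℝ (BaseModel n × EF)
        (BaseModel n →L[ℝ] EF)).hasFDerivAt.comp_hasDerivAt t h1
    have h5 := (L.differentiableAt_coordLagrangian A (γ t) (hAt t ht)).hasFDerivAt.comp_hasDerivAt
      (f := c) t h1
    have h6 : fderiv ℝ (L.coordLagrangian A) (c t) (deriv c t) - σ (deriv c t).2 = 0 := by
      have h7 : deriv c t = (0, (deriv c t).2) := Prod.ext h3 rfl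
      rw [hσ, ← hcP t ht, L.sum_coordMomentum A, ← h7, sub_self]
    rw [← h6]
    exact h5.sub h4
  have hconst := hO.is_const_of_deriv_eq_zero hO'
    (fun t ht => (hder t ht).differentiableAt.differentiableWithinAt)
    (fun t ht => (hder t ht).deriv) ha hb
  refine L.homLegendre_eq_of_chart (hAt a ha) (hAt b hb) ((hpt a ha).trans (hpt b hb).symm) ?_
  -- In the normal form of `cartanForm_eq` the two ends share the momenta `P`, so only the constancy
  -- of $p$ is needed.
  rw [show L.coordMomentum A (B.jetAtlas.chart A (γ a)) = P from hcP a ha,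
    show L.coordMomentum A (B.jetAtlas.chart A (γ b)) = P from hcP b hb, cartanForm_eq,
    cartanForm_eq (L.coordLagrangian A (B.jetAtlas.chart A (γ b))), ← hσ, ← hσ]
  exact congrArg (fun ℓ => cartanForm ℓ P 0) hconst

variable {EN EG G : Type*}
    [NormedAddCommGroup EN] [NormedSpace ℝ EN] [ChartedSpace EN L.NSpace]
    [NormedAddCommGroup EG] [NormedSpace ℝ EG] [TopologicalSpace G] [ChartedSpace EG G]

variable {L}

/-- For an almost regular Lagrangian, the Legendre morphism to `Z_Y` is constant on the fibres of
the Legendre map. -/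
theorem IsAlmostRegular.homLegendre_eq (hL : L.IsAlmostRegular EN EG G) {j j' : B.Jet}
    (h : L.legendreN j = L.legendreN j') : L.homLegendre j = L.homLegendre j' := by
  have hT := hL.isConnected_fibre (L.legendreN j)
  set T : Set B.Jet := L.legendreN ⁻¹' {L.legendreN j} with hTdef
  have : PreconnectedSpace T := isPreconnected_iff_preconnectedSpace.1 hT.isPreconnected
  -- The curves in the fibre exist only between nearby points and give local constancy;
  -- connectedness of the fibre makes it global.
  have hloc : IsLocallyConstant (fun i : T => L.homLegendre i.1) := by
    rw [IsLocallyConstant.iff_eventually_eq]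
    intro i
    have h1 := (hL.isSubmersion.isSubmersionAt i.1).exists_curve_in_fibre
    filter_upwards [continuous_subtype_val.continuousAt.eventually h1] with i' hi'
    obtain ⟨O, γ, hO, hO', h0, h1, hγ, hγ0, hγ1, hγf⟩ := hi' (i'.2.trans i.2.symm)
    rw [← hγ0, ← hγ1]
    exact L.homLegendre_eq_of_curve hO hO' hγ
      (fun t ht => congrArg Subtype.val (hγf t ht)) h1 h0
  exact hloc.apply_eq_of_preconnectedSpace (⟨j, rfl⟩ : T) ⟨j', h.symm⟩

end Lagrangian

end FibreBundle

/-! ### Tangent maps, and the exterior derivative of a pull-back -/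

section Forms

variable {E M E' M' E'' M'' : Type*}
  [NormedAddCommGroup E] [NormedSpace ℝ E] [TopologicalSpace M] [ChartedSpace E M]
  [NormedAddCommGroup E'] [NormedSpace ℝ E'] [TopologicalSpace M'] [ChartedSpace E' M']
  [NormedAddCommGroup E''] [NormedSpace ℝ E''] [TopologicalSpace M''] [ChartedSpace E'' M'']

theorem tangentMapAt_comp {f : M → M'} {g : M' → M''} {m : M}
    (hg : MDifferentiableAt 𝓘(ℝ, E') 𝓘(ℝ, E'') g (f m))
    (hf : MDifferentiableAt 𝓘(ℝ, E) 𝓘(ℝ, E') f m) :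
    tangentMapAt E E'' (g ∘ f) m = tangentMapAt E' E'' g (f m) ∘L tangentMapAt E E' f m :=
  mfderiv_comp m hg hf

theorem tangentMapAt_id (m : M) : tangentMapAt E E (id : M → M) m = ContinuousLinearMap.id ℝ E :=
  mfderiv_id

theorem tangentMapAt_congr {f g : M → M'} {m : M} (h : f =ᶠ[𝓝 m] g) :
    tangentMapAt E E' f m = tangentMapAt E E' g m :=
  h.mfderiv_eq

/-- In the preferred charts, the tangent map is the derivative of the coordinate expression. -/
theorem tangentMapAt_eq_fderiv {f : M → M'} {m : M}
    (hf : MDifferentiableAt 𝓘(ℝ, E) 𝓘(ℝ, E') f m) :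
    tangentMapAt E E' f m =
      fderiv ℝ (chartAt E' (f m) ∘ f ∘ (chartAt E m).symm) (chartAt E m m) := by
  have h : mfderiv 𝓘(ℝ, E) 𝓘(ℝ, E') f m = fderivWithin ℝ
      (writtenInExtChartAt 𝓘(ℝ, E) 𝓘(ℝ, E') m f) (range 𝓘(ℝ, E)) (extChartAt 𝓘(ℝ, E) m m) :=
    hf.mfderiv
  refine h.trans ?_
  simp only [modelWithCornersSelf_coe, range_id, fderivWithin_univ]
  simp only [mfld_simps]
  rfl

/-- The exterior derivative commutes with pull-back. -/
theorem DiffForm.d_pullback [IsManifold 𝓘(ℝ, E) ∞ M] [IsManifold 𝓘(ℝ, E') ∞ M'] {k : ℕ}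
    {f : M → M'} (hf : ContMDiff 𝓘(ℝ, E) 𝓘(ℝ, E') ∞ f) {α : DiffForm E' M' k} {m : M}
    (hα : DifferentiableAt ℝ (DiffForm.pullback (E := E') (M := E') (chartAt E' (f m)).symm α)
      (chartAt E' (f m) (f m))) :
    (DiffForm.pullback (E := E) f α).d m =
      (α.d (f m)).compContinuousLinearMap (tangentMapAt E E' f m) := by
  set c := chartAt E m with hc
  set c' := chartAt E' (f m) with hc'
  set h : E → E' := c' ∘ f ∘ c.symm with hh
  have hm : m ∈ c.source := mem_chart_source E m
  have hfm : f m ∈ c'.source := mem_chart_source E' (f m)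
  have hcs : ContMDiffOn 𝓘(ℝ, E) 𝓘(ℝ, E) ∞ c.symm c.target := contMDiffOn_chart_symm
  have hc1 : ContMDiffOn 𝓘(ℝ, E') 𝓘(ℝ, E') ∞ c' c'.source := contMDiffOn_chart
  have hc2 : ContMDiffOn 𝓘(ℝ, E') 𝓘(ℝ, E') ∞ c'.symm c'.target := contMDiffOn_chart_symm
  set s : Set E := c.target ∩ c.symm ⁻¹' (f ⁻¹' c'.source) with hs
  have hso : IsOpen s :=
    c.continuousOn_symm.isOpen_inter_preimage c.open_target (c'.open_source.preimage hf.continuous)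
  have hms : c m ∈ s := ⟨c.map_source hm, by simpa [c.left_inv hm] using hfm⟩
  have hfc : ContMDiffOn 𝓘(ℝ, E) 𝓘(ℝ, E') ∞ (f ∘ c.symm) s :=
    hf.comp_contMDiffOn (hcs.mono inter_subset_left)
  have hsm : ContMDiffOn 𝓘(ℝ, E) 𝓘(ℝ, E') ∞ h s := hc1.comp hfc fun x hx => hx.2
  have hhm : h (c m) = c' (f m) := by simp [hh, c.left_inv hm]
  -- On the open set `s` the local expression of $f^*\alpha$ is the pull-back of the local
  -- expression of $\alpha$ by the coordinate map `h`. This reduces the claim to naturality of $d$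
  -- in normed spaces, since the exterior derivative depends only on the germ.
  have heq : ∀ x ∈ s, DiffForm.pullback (E := E) (M := E) c.symm (DiffForm.pullback (E := E) f α) x =
      (DiffForm.pullback (E := E') (M := E') c'.symm α (h x)).compContinuousLinearMap (fderiv ℝ h x) := by
    intro x hx
    have hx' : s ∈ 𝓝 x := hso.mem_nhds hx
    have hd1 : MDifferentiableAt 𝓘(ℝ, E) 𝓘(ℝ, E) c.symm x :=
      ((hcs.mono inter_subset_left).contMDiffAt hx').mdifferentiableAt (by simp)
    have hd2 : MDifferentiableAt 𝓘(ℝ, E) 𝓘(ℝ, E') h x :=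
      (hsm.contMDiffAt hx').mdifferentiableAt (by simp)
    have hd3 : MDifferentiableAt 𝓘(ℝ, E') 𝓘(ℝ, E') c'.symm (h x) :=
      (hc2.contMDiffAt (c'.open_target.mem_nhds (c'.map_source hx.2))).mdifferentiableAt (by simp)
    have e1 := tangentMapAt_comp (hf.mdifferentiableAt (by simp) (x := c.symm x)) hd1
    have e2 := tangentMapAt_comp hd3 hd2
    have e3 : tangentMapAt E E' (c'.symm ∘ h) x = tangentMapAt E E' (f ∘ c.symm) x :=
      tangentMapAt_congr (Filter.eventuallyEq_of_mem hx' fun z hz => c'.left_inv hz.2)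
    have e4 : tangentMapAt E E' h x = fderiv ℝ h x := mfderiv_eq_fderiv
    have e5 : c'.symm (h x) = f (c.symm x) := c'.left_inv hx.2
    have e6 := (e2.symm.trans e3).trans e1
    rw [e4] at e6
    -- The point at which $\alpha$ is taken is generalised to `y`, so that the equality `e5` of
    -- points can be substituted.
    have h1 : ∀ y, y = f (c.symm x) → ((α y).compContinuousLinearMap
        (tangentMapAt E' E' c'.symm (h x))).compContinuousLinearMap (fderiv ℝ h x) =
        ((α (f (c.symm x))).compContinuousLinearMap
          (tangentMapAt E E' f (c.symm x))).compContinuousLinearMap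
            (tangentMapAt E E c.symm x) := by
      rintro y rfl
      ext v
      exact congrArg (α (f (c.symm x))) (funext fun i => congrArg (fun l => l (v i)) e6)
    exact (h1 _ e5).symm
  unfold DiffForm.d
  rw [(Filter.eventuallyEq_of_mem (hso.mem_nhds hms) heq).extDeriv_eq,
    extDeriv_pullback (r := ∞) (by rw [hhm]; exact hα)
      (contMDiffAt_iff_contDiffAt.1 (hsm.contMDiffAt (hso.mem_nhds hms)))
      (by simpa using WithTop.coe_le_coe.2 (le_top (a := (2 : ℕ∞)))), hhm,
    tangentMapAt_eq_fderiv (hf.mdifferentiableAt (by simp))]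

end Forms

/-! ### Invariance of $r^*(u\rfloor d\alpha)=0$ under diffeomorphisms over the base -/

section Equations

variable {n : ℕ} {X M M' E E' : Type*} [TopologicalSpace X] [ChartedSpace (BaseModel n) X]
  [NormedAddCommGroup E] [NormedSpace ℝ E] [TopologicalSpace M] [ChartedSpace E M]
  [IsManifold 𝓘(ℝ, E) ∞ M]
  [NormedAddCommGroup E'] [NormedSpace ℝ E'] [TopologicalSpace M'] [ChartedSpace E' M']
  [IsManifold 𝓘(ℝ, E') ∞ M']

/-- The push-forward of a vertical vector field by a diffeomorphism over the base. -/
theorem IsVerticalField.exists_pushforward (φ : Diffeomorph 𝓘(ℝ, E) 𝓘(ℝ, E') M M' ∞)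
    {p : M → X} {p' : M' → X} (hp' : MDifferentiable 𝓘(ℝ, E') 𝓘(ℝ, BaseModel n) p')
    (hφ : ∀ m, p' (φ m) = p m) {u : ∀ m : M, TangentSpace 𝓘(ℝ, E) m}
    (hu : IsVerticalField n p u) :
    ∃ u' : ∀ m : M', TangentSpace 𝓘(ℝ, E') m, IsVerticalField n p' u' ∧
      ∀ m, u' (φ m) = tangentMapAt E E' φ m (u m) := by
  refine ⟨fun m' => tangentMapAt E E' φ (φ.symm m') (u (φ.symm m')), ⟨?_, ?_⟩, ?_⟩
  · have h1 : ContMDiff 𝓘(ℝ, E).tangent 𝓘(ℝ, E').tangent ∞ (tangentMap 𝓘(ℝ, E) 𝓘(ℝ, E') φ) :=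
      φ.contMDiff.contMDiff_tangentMap (by simp)
    have h2 := h1.comp (hu.contMDiff.comp φ.symm.contMDiff)
    convert h2 using 2 with m'
    have h3 : ∀ y, φ (φ.symm m') = y →
        (⟨y, tangentMapAt E E' φ (φ.symm m') (u (φ.symm m'))⟩ : TangentBundle 𝓘(ℝ, E') M') =
        ⟨φ (φ.symm m'), tangentMapAt E E' φ (φ.symm m') (u (φ.symm m'))⟩ := by
      rintro y rfl
      rfl
    exact h3 m' (φ.apply_symm_apply m')
  · have key : ∀ m, tangentMapAt E' (BaseModel n) p' (φ m) (tangentMapAt E E' φ m (u m)) = 0 := by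
      intro m
      have h1 := tangentMapAt_comp (hp' (φ m)) (φ.contMDiff.mdifferentiableAt (by simp) (x := m))
      have h2 : (p' ∘ φ) = p := funext hφ
      rw [h2] at h1
      exact (congrArg (fun l => l (u m)) h1).symm.trans (hu.vertical m)
    intro m'
    have := key (φ.symm m')
    rwa [φ.apply_symm_apply] at this
  · intro m
    have h3 : ∀ y, y = m → tangentMapAt E E' φ y (u y) = tangentMapAt E E' φ m (u m) := by
      rintro y rfl
      rfl
    exact h3 _ (φ.symm_apply_apply m)

/-- The equations `r^*(u ⌋ dα) = 0` are invariant under diffeomorphisms over the base. -/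
theorem solvesHamiltonEquations_pullback_iff (φ : Diffeomorph 𝓘(ℝ, E) 𝓘(ℝ, E') M M' ∞)
    {p : M → X} {p' : M' → X} (hp : MDifferentiable 𝓘(ℝ, E) 𝓘(ℝ, BaseModel n) p)
    (hp' : MDifferentiable 𝓘(ℝ, E') 𝓘(ℝ, BaseModel n) p') (hφ : ∀ m, p' (φ m) = p m)
    {α : DiffForm E' M' (n + 1)}
    (hα : ∀ m, DifferentiableAt ℝ (DiffForm.pullback (E := E') (M := E') (chartAt E' m).symm α)
      (chartAt E' m m)) {U : Set X} {r : X → M}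
    (hr : ∀ x ∈ U, MDifferentiableAt 𝓘(ℝ, BaseModel n) 𝓘(ℝ, E) r x) :
    SolvesHamiltonEquations p (DiffForm.pullback (E := E) φ α) U r ↔
      SolvesHamiltonEquations p' α U (φ ∘ r) := by
  -- Pointwise naturality: $r^*(v\rfloor d\varphi^*\alpha)=(\varphi\circ r)^*(T\varphi(v)\rfloor
  -- d\alpha)$. What remains is to match the vertical fields on the two sides.
  have key : ∀ x ∈ U, ∀ v : E, (((DiffForm.pullback (E := E) φ α).d (r x)).curryLeft
      v).compContinuousLinearMap (tangentMapAt (BaseModel n) E r x) =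
      ((α.d (φ (r x))).curryLeft (tangentMapAt E E' φ (r x) v)).compContinuousLinearMap
        (tangentMapAt (BaseModel n) E' (φ ∘ r) x) := by
    intro x hx v
    rw [DiffForm.d_pullback φ.contMDiff (hα _),
      tangentMapAt_comp (φ.contMDiff.mdifferentiableAt (by simp)) (hr x hx),
      ContinuousAlternatingMap.curryLeft_compContinuousLinearMap]
    rfl
  constructor
  · intro h u' hu' x hx
    -- A test field on $M'$ is moved to $M$ by $\varphi^{-1}$; pushing it forward again returns the
    -- original vector, since $T\varphi\circ T\varphi^{-1}=\mathrm{id}$.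
    obtain ⟨u, hu, huu⟩ := hu'.exists_pushforward φ.symm hp
      (fun m' => by rw [← hφ, φ.apply_symm_apply])
    have h1 : tangentMapAt E E' φ (r x) (u (r x)) = u' (φ (r x)) := by
      have h2 := huu (φ (r x))
      rw [φ.symm_apply_apply] at h2
      rw [h2]
      have h3 : MDifferentiableAt 𝓘(ℝ, E) 𝓘(ℝ, E') φ (φ.symm (φ (r x))) :=
        φ.contMDiff.mdifferentiableAt (by simp)
      have h4 := tangentMapAt_comp h3 (φ.symm.contMDiff.mdifferentiableAt (by simp))
      have h5 : (φ ∘ φ.symm : M' → M') = id := funext φ.apply_symm_apply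
      rw [h5, tangentMapAt_id, φ.symm_apply_apply] at h4
      exact (congrArg (fun l => l (u' (φ (r x)))) h4).symm
    have h2 := h u hu x hx
    have h3 := (key x hx (u (r x))).symm.trans h2
    rw [h1] at h3
    exact h3
  · intro h u hu x hx
    obtain ⟨u', hu', huu⟩ := hu.exists_pushforward φ hp' hφ
    have h2 := h u' hu' x hx
    refine (key x hx (u (r x))).trans ?_
    rw [← huu (r x)]
    exact h2

end Equations

/-! ### The diffeomorphism $N_L\cong Z_L$ and the De Donder form -/

namespace FibreBundle

variable {n : ℕ} {EY EF X Y F : Type*}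
  [NormedAddCommGroup EY] [NormedSpace ℝ EY] [NormedAddCommGroup EF] [NormedSpace ℝ EF]
  [TopologicalSpace X] [ChartedSpace (BaseModel n) X]
  [TopologicalSpace Y] [ChartedSpace EY Y]
  [TopologicalSpace F] [ChartedSpace EF F]
  {B : FibreBundle n EY EF X Y F}
  [IsManifold 𝓘(ℝ, BaseModel n) ∞ X] [IsManifold 𝓘(ℝ, EF) ∞ F]

theorem Jet.contMDiff_pt : ContMDiff 𝓘(ℝ, JetModel n EF) 𝓘(ℝ, EY) ∞ (Jet.pt (B := B)) :=
  B.jetAtlas.contMDiff_fst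

variable [FiniteDimensional ℝ EF]

theorem Legendre.contMDiff_pt :
    ContMDiff 𝓘(ℝ, LegendreModel n EF) 𝓘(ℝ, EY) ∞ (Legendre.pt (B := B)) :=
  B.legendreAtlas.contMDiff_fst

theorem HomLegendre.contMDiff_pt :
    ContMDiff 𝓘(ℝ, HomLegendreModel n EF) 𝓘(ℝ, EY) ∞ (HomLegendre.pt (B := B)) :=
  B.homLegendreAtlas.contMDiff_fst

namespace Lagrangian

variable {L : B.Lagrangian}
  {EN : Type*} [NormedAddCommGroup EN] [NormedSpace ℝ EN] [ChartedSpace EN L.NSpace]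
  {EZ : Type*} [NormedAddCommGroup EZ] [NormedSpace ℝ EZ] [ChartedSpace EZ L.ZSpace]

/-- The projection `Z_L → N_L`, `Ĥ_L(j) ↦ L̂(j)`. -/
def legendreOfHom (z : L.ZSpace) : L.NSpace := L.legendreN z.2.choose

/-- The jet picked in `legendreOfHom` need not be $j$, but it has the same image under $\widehat
H_L$, and that image determines $\widehat L$. -/
theorem legendreOfHom_homLegendreZ (j : B.Jet) :
    legendreOfHom (L.homLegendreZ j) = L.legendreN j :=
  Subtype.ext (L.legendre_eq_of_homLegendre_eq (L.homLegendreZ j).2.choose_spec)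

theorem contMDiff_legendreOfHom
    (hN : Manifold.IsSmoothEmbedding 𝓘(ℝ, EN) 𝓘(ℝ, LegendreModel n EF) ∞
      (Subtype.val : L.NSpace → B.Legendre))
    (hZ : Manifold.IsSmoothEmbedding 𝓘(ℝ, EZ) 𝓘(ℝ, HomLegendreModel n EF) ∞
      (Subtype.val : L.ZSpace → B.HomLegendre)) :
    ContMDiff 𝓘(ℝ, EZ) 𝓘(ℝ, EN) ∞ (legendreOfHom (L := L)) := by
  have hval : ContMDiff 𝓘(ℝ, EZ) 𝓘(ℝ, LegendreModel n EF) ∞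
      (fun z : L.ZSpace => (legendreOfHom z).1) := by
    intro z
    obtain ⟨A, hA⟩ := B.exists_adaptedChart z.1.pt
    obtain ⟨s, hs⟩ := exists_leftInverse_cartanForm (n := n) (V := EF)
    have hpt : ∀ z : L.ZSpace, (legendreOfHom z).1.pt = z.1.pt := fun z =>
      congrArg (fun w : B.HomLegendre => w.pt) z.2.choose_spec
    -- No smooth choice of jets is needed: in coordinates the map is the fixed linear map `s`
    -- applied to the fibre coordinate of $z$, whichever jet was chosen.
    have hchart : ∀ z : L.ZSpace, z.1.pt ∈ A.total.source →
        (B.legendreAtlas.chart A (legendreOfHom z).1).2 =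
          s (B.homLegendreAtlas.chart A z.1).2.1 := by
      intro z hz
      have hj := z.2.choose_spec
      set j := z.2.choose with hjdef
      have hjA : j.pt ∈ A.total.source := by
        rw [← hj] at hz
        exact hz
      rw [← hj, L.homLegendreAtlas_chart_homLegendre j hjA, hs]
      exact L.legendreAtlas_chart_legendre j hjA
    have h1 : ContMDiff 𝓘(ℝ, EZ) 𝓘(ℝ, EY) ∞ (fun z : L.ZSpace => z.1.pt) :=
      HomLegendre.contMDiff_pt.comp hZ.contMDiff
    have h2 : ContMDiffAt 𝓘(ℝ, EZ) 𝓘(ℝ, HomLegendreModel n EF) ∞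
        (fun z : L.ZSpace => B.homLegendreAtlas.chart A z.1) z :=
      B.homLegendreAtlas.contMDiffAt_chart_comp A hA hZ.contMDiff.contMDiffAt
    let σ : HomLegendreModel n EF →L[ℝ]
        (EF →L[ℝ] (BaseModel n →L[ℝ] ℝ) →L[ℝ] (BaseModel n [⋀^Fin (n + 1)]→L[ℝ] ℝ)) :=
      s ∘L (Submodule.subtypeL _) ∘L ContinuousLinearMap.snd ℝ (BaseModel n × EF) _
    have h3 := σ.contDiff.contMDiff.contMDiffAt.comp z h2
    have hA' : (legendreOfHom z).1.pt ∈ A.total.source := (hpt z).symm ▸ hA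
    refine B.legendreAtlas.contMDiffAt_of_fst_of_chart A hA'
      (h1.contMDiffAt.congr_of_eventuallyEq (Filter.Eventually.of_forall hpt))
      (h3.congr_of_eventuallyEq ?_)
    filter_upwards [h1.continuous.continuousAt.preimage_mem_nhds (A.total.open_source.mem_nhds hA)]
      with z' hz' using hchart z' hz'
  -- Smoothness into the embedded submanifold follows from smoothness into $\Pi$ together with
  -- continuity, which holds because $N_L$ carries the subspace topology.
  exact (ContMDiff.iff_comp_isImmersion hN.isImmersion).2
    ⟨hval.continuous.subtype_mk _, hval⟩

theorem contMDiff_homLegendreZ_comp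
    (hZ : Manifold.IsSmoothEmbedding 𝓘(ℝ, EZ) 𝓘(ℝ, HomLegendreModel n EF) ∞
      (Subtype.val : L.ZSpace → B.HomLegendre))
    {Ψ : L.NSpace → B.Jet} (hΨ : L.IsGlobalSection EN Ψ) :
    ContMDiff 𝓘(ℝ, EN) 𝓘(ℝ, EZ) ∞ (fun q => L.homLegendreZ (Ψ q)) := by
  have hval : ContMDiff 𝓘(ℝ, EN) 𝓘(ℝ, HomLegendreModel n EF) ∞ (fun q => L.homLegendre (Ψ q)) :=
    L.contMDiff_homLegendre.comp hΨ.contMDiff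
  exact (ContMDiff.iff_comp_isImmersion hZ.isImmersion).2 ⟨hval.continuous.subtype_mk _, hval⟩

theorem IsGlobalSection.legendre_apply {Ψ : L.NSpace → B.Jet} (hΨ : L.IsGlobalSection EN Ψ)
    (q : L.NSpace) : L.legendre (Ψ q) = q.1 :=
  congrArg Subtype.val (hΨ.legendreN_apply q)

theorem IsGlobalSection.pt_apply {Ψ : L.NSpace → B.Jet} (hΨ : L.IsGlobalSection EN Ψ)
    (q : L.NSpace) : (Ψ q).pt = q.1.pt :=
  congrArg (fun z : B.Legendre => z.pt) (hΨ.legendre_apply q)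

/-- The diffeomorphism `Ĥ_L ∘ Ψ : N_L → Z_L` for an almost regular Lagrangian. -/
def IsAlmostRegular.diffeomorph {EG G : Type*} [NormedAddCommGroup EG] [NormedSpace ℝ EG]
    [TopologicalSpace G] [ChartedSpace EG G] (hL : L.IsAlmostRegular EN EG G)
    (hZ : Manifold.IsSmoothEmbedding 𝓘(ℝ, EZ) 𝓘(ℝ, HomLegendreModel n EF) ∞
      (Subtype.val : L.ZSpace → B.HomLegendre))
    {Ψ : L.NSpace → B.Jet} (hΨ : L.IsGlobalSection EN Ψ) :
    Diffeomorph 𝓘(ℝ, EN) 𝓘(ℝ, EZ) L.NSpace L.ZSpace ∞ where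
  toFun q := L.homLegendreZ (Ψ q)
  invFun := legendreOfHom
  left_inv q := by rw [legendreOfHom_homLegendreZ, hΨ.legendreN_apply]
  -- The jet $\Psi(\widehat L(j))$ lies in the same fibre of $\widehat L$ as the jet $j$ chosen over
  -- $z$, so both have the same image under $\widehat H_L$. This is where connectedness of the
  -- fibres enters.
  right_inv z := Subtype.ext <|
    (hL.homLegendre_eq (hΨ.legendreN_apply _)).trans z.2.choose_spec
  contMDiff_toFun := contMDiff_homLegendreZ_comp hZ hΨ
  contMDiff_invFun := contMDiff_legendreOfHom hL.isSmoothEmbedding hZ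

/-- The constrained Hamiltonian form is the pull-back of the De Donder form. -/
theorem constrainedForm_eq_pullback
    (hZ : Manifold.IsSmoothEmbedding 𝓘(ℝ, EZ) 𝓘(ℝ, HomLegendreModel n EF) ∞
      (Subtype.val : L.ZSpace → B.HomLegendre))
    {Ψ : L.NSpace → B.Jet} (hΨ : L.IsGlobalSection EN Ψ) :
    L.constrainedForm EN Ψ =
      DiffForm.pullback (fun q => L.homLegendreZ (Ψ q)) (L.deDonderForm EZ) := by
  funext q
  have hφ := contMDiff_homLegendreZ_comp hZ hΨ
  have hv : MDifferentiableAt 𝓘(ℝ, EZ) 𝓘(ℝ, HomLegendreModel n EF)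
      (Subtype.val : L.ZSpace → B.HomLegendre) (L.homLegendreZ (Ψ q)) :=
    hZ.contMDiff.mdifferentiableAt (by simp)
  have e1 := tangentMapAt_comp (Jet.contMDiff_pt.mdifferentiableAt (by simp))
    (hΨ.contMDiff.mdifferentiableAt (by simp) (x := q))
  have e2 := tangentMapAt_comp (f := fun q => L.homLegendreZ (Ψ q)) hv
    (hφ.mdifferentiableAt (by simp) (x := q))
  have e3 := tangentMapAt_comp (f := Subtype.val ∘ fun q => L.homLegendreZ (Ψ q)) (m := q)
    (HomLegendre.contMDiff_pt.mdifferentiableAt (by simp))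
    (hv.comp q (hφ.mdifferentiableAt (by simp)))
  rw [e2] at e3
  ext v
  -- $\Xi_Y$ at $\widehat H_L(j)$ and $H_L$ at $j$ are pull-backs of the same form on $T_yY$. It
  -- remains only that the two routes from $N_L$ to $Y$, through $J^1Y$ and through $Z_L$, have the
  -- same tangent map.
  exact congrArg (L.poincareCartanAt (Ψ q))
    (funext fun i => congrArg (fun l => l (v i)) (e1.symm.trans e3))

/-- The De Donder form is smooth in charts. -/
theorem differentiableAt_deDonderForm [IsManifold 𝓘(ℝ, EZ) ∞ L.ZSpace] [FiniteDimensional ℝ EZ]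
    (hZ : Manifold.IsSmoothEmbedding 𝓘(ℝ, EZ) 𝓘(ℝ, HomLegendreModel n EF) ∞
      (Subtype.val : L.ZSpace → B.HomLegendre)) (z : L.ZSpace) :
    DifferentiableAt ℝ (DiffForm.pullback (E := EZ) (M := EZ) (chartAt EZ z).symm
      (L.deDonderForm EZ)) (chartAt EZ z z) := by
  obtain ⟨A, hA⟩ := B.exists_adaptedChart z.1.pt
  set c := chartAt EZ z with hc
  have hzc : z ∈ c.source := mem_chart_source EZ z
  have hpt : ContMDiff 𝓘(ℝ, EZ) 𝓘(ℝ, EY) ∞ (fun z : L.ZSpace => z.1.pt) :=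
    HomLegendre.contMDiff_pt.comp hZ.contMDiff
  have hcs : ContMDiffOn 𝓘(ℝ, EZ) 𝓘(ℝ, EZ) ∞ c.symm c.target := contMDiffOn_chart_symm
  set s : Set EZ := c.target ∩ c.symm ⁻¹' {z | z.1.pt ∈ A.total.source} with hs
  have hso : IsOpen s := c.continuousOn_symm.isOpen_inter_preimage c.open_target
    (A.total.open_source.preimage hpt.continuous)
  have hzs : c z ∈ s := ⟨c.map_source hzc, by simpa [c.left_inv hzc] using hA⟩
  have hptc : ContMDiffOn 𝓘(ℝ, EZ) 𝓘(ℝ, EY) ∞ (fun x => (c.symm x).1.pt) s :=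
    hpt.comp_contMDiffOn (hcs.mono inter_subset_left)
  have hg : ContDiffOn ℝ ∞ (fun x => A.total (c.symm x).1.pt) s :=
    contMDiffOn_iff_contDiffOn.1 (A.contMDiffOn_total.comp hptc fun x hx => hx.2)
  have hζ : ContDiffOn ℝ ∞ (fun x => (B.homLegendreAtlas.chart A (c.symm x).1).2.1) s := by
    intro x hx
    have h1 : ContMDiffAt 𝓘(ℝ, EZ) 𝓘(ℝ, EZ) ∞ c.symm x :=
      (hcs.mono inter_subset_left).contMDiffAt (hso.mem_nhds hx)
    have h2 : ContMDiffAt 𝓘(ℝ, EZ) 𝓘(ℝ, HomLegendreModel n EF) ∞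
        (fun x => B.homLegendreAtlas.chart A (c.symm x).1) x :=
      B.homLegendreAtlas.contMDiffAt_chart_comp A hx.2 (hZ.contMDiff.contMDiffAt.comp x h1)
    exact ((Submodule.subtypeL _ ∘L ContinuousLinearMap.snd ℝ (BaseModel n × EF)
      _).contDiff.comp_contDiffAt x (contMDiffAt_iff_contDiffAt.1 h2)).contDiffWithinAt
  -- In coordinates the tautological form at a point is its own fibre coordinate, pulled back by the
  -- derivative of $(x^\lambda,y^i)$; both depend smoothly on the point.
  have hmain := contDiffOn_alternating_comp hζ (hg.fderiv_of_isOpen hso (m := ∞) (by simp))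
  refine ((hmain.contDiffAt (hso.mem_nhds hzs)).differentiableAt
    (by simp)).congr_of_eventuallyEq ?_
  filter_upwards [hso.mem_nhds hzs] with x hx
  have hcx : MDifferentiableAt 𝓘(ℝ, EZ) 𝓘(ℝ, EZ) c.symm x :=
    ((hcs.mono inter_subset_left).contMDiffAt (hso.mem_nhds hx)).mdifferentiableAt (by simp)
  have hv : MDifferentiableAt 𝓘(ℝ, EZ) 𝓘(ℝ, HomLegendreModel n EF)
      (Subtype.val : L.ZSpace → B.HomLegendre) (c.symm x) :=
    hZ.contMDiff.mdifferentiableAt (by simp)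
  have hp : MDifferentiableAt 𝓘(ℝ, HomLegendreModel n EF) 𝓘(ℝ, EY) (HomLegendre.pt (B := B))
      (c.symm x).1 := HomLegendre.contMDiff_pt.mdifferentiableAt (by simp)
  have ht : MDifferentiableAt 𝓘(ℝ, EY) 𝓘(ℝ, BaseModel n × EF) A.total (c.symm x).1.pt :=
    A.mdifferentiable_total.mdifferentiableAt hx.2
  have e1 := tangentMapAt_comp hv hcx
  have e2 := tangentMapAt_comp (f := Subtype.val ∘ c.symm) (m := x) hp (hv.comp x hcx)
  have e3 := tangentMapAt_comp (f := HomLegendre.pt ∘ Subtype.val ∘ c.symm) (m := x) ht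
    (hp.comp x (hv.comp x hcx))
  have e4 : tangentMapAt EZ (BaseModel n × EF)
      (A.total ∘ HomLegendre.pt ∘ Subtype.val ∘ c.symm) x =
      fderiv ℝ (fun x => A.total (c.symm x).1.pt) x := mfderiv_eq_fderiv
  rw [e2, e1] at e3
  have e5 := e4.symm.trans e3
  rw [B.homLegendreAtlas.chart_apply A (c.symm x).1 hx.2, e5]
  ext v
  refine congrArg (c.symm x).1.form (funext fun i => ?_)
  exact ((A.dTotal hx.2).symm_apply_apply _).symm

end Lagrangian

end FibreBundle

end

/-! ### Equivalence of the constrained Hamilton and Hamilton–De Donder equations -/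

theorem theorem3p02 {n : ℕ} {EY EF X Y F : Type*}
    [NormedAddCommGroup EY] [NormedSpace ℝ EY] [FiniteDimensional ℝ EY]
    [NormedAddCommGroup EF] [NormedSpace ℝ EF] [FiniteDimensional ℝ EF]
    [TopologicalSpace X] [ChartedSpace (BaseModel n) X] [IsManifold 𝓘(ℝ, BaseModel n) ∞ X]
    [T2Space X] [SecondCountableTopology X] [ConnectedSpace X]
    [TopologicalSpace Y] [ChartedSpace EY Y] [IsManifold 𝓘(ℝ, EY) ∞ Y]
    [T2Space Y] [SecondCountableTopology Y] [ConnectedSpace Y]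
    [TopologicalSpace F] [ChartedSpace EF F] [IsManifold 𝓘(ℝ, EF) ∞ F]
    (B : FibreBundle n EY EF X Y F) (L : B.Lagrangian)
    {EN : Type*} [NormedAddCommGroup EN] [NormedSpace ℝ EN] [FiniteDimensional ℝ EN]
    [ChartedSpace EN L.NSpace] [IsManifold 𝓘(ℝ, EN) ∞ L.NSpace]
    {EG G : Type*} [NormedAddCommGroup EG] [NormedSpace ℝ EG] [FiniteDimensional ℝ EG]
    [TopologicalSpace G] [ChartedSpace EG G] [IsManifold 𝓘(ℝ, EG) ∞ G]
    (hL : L.IsAlmostRegular EN EG G)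
    (hΨ : ∃ Ψ : L.NSpace → B.Jet, L.IsGlobalSection EN Ψ)
    {EZ : Type*} [NormedAddCommGroup EZ] [NormedSpace ℝ EZ] [FiniteDimensional ℝ EZ]
    [ChartedSpace EZ L.ZSpace] [IsManifold 𝓘(ℝ, EZ) ∞ L.ZSpace]
    (hZ : Manifold.IsSmoothEmbedding 𝓘(ℝ, EZ) 𝓘(ℝ, FibreBundle.HomLegendreModel n EF) ∞
      (Subtype.val : L.ZSpace → B.HomLegendre)) :
    ∃ φ : Diffeomorph 𝓘(ℝ, EN) 𝓘(ℝ, EZ) L.NSpace L.ZSpace ∞,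
      (∀ q, (φ q).1.pt = q.1.pt) ∧
      ∀ Ψ : L.NSpace → B.Jet, L.IsGlobalSection EN Ψ →
        (∀ q, φ q = L.homLegendreZ (Ψ q)) ∧
        L.constrainedForm EN Ψ = DiffForm.pullback φ (L.deDonderForm EZ) ∧
        ∀ U : Set X, IsOpen U →
          (∀ r : X → L.NSpace, IsSmoothSectionOn n EN L.projN U r →
            (SolvesHamiltonEquations L.projN (L.constrainedForm EN Ψ) U r ↔
              SolvesHamiltonEquations L.projZ (L.deDonderForm EZ) U (φ ∘ r))) ∧
          (∀ s : X → L.ZSpace, IsSmoothSectionOn n EZ L.projZ U s →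
            (SolvesHamiltonEquations L.projZ (L.deDonderForm EZ) U s ↔
              SolvesHamiltonEquations L.projN (L.constrainedForm EN Ψ) U (φ.symm ∘ s))) := by
  obtain ⟨Ψ₀, hΨ₀⟩ := hΨ
  have hval : ContMDiff 𝓘(ℝ, EN) 𝓘(ℝ, FibreBundle.LegendreModel n EF) ∞
      (Subtype.val : L.NSpace → B.Legendre) := hL.isSmoothEmbedding.contMDiff
  have hpN : MDifferentiable 𝓘(ℝ, EN) 𝓘(ℝ, BaseModel n) L.projN :=
    (B.isSmoothFibreBundle.contMDiff.comp
      (FibreBundle.Legendre.contMDiff_pt.comp hval)).mdifferentiable (by simp)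
  have hpZ : MDifferentiable 𝓘(ℝ, EZ) 𝓘(ℝ, BaseModel n) L.projZ :=
    (B.isSmoothFibreBundle.contMDiff.comp
      (FibreBundle.HomLegendre.contMDiff_pt.comp hZ.contMDiff)).mdifferentiable (by simp)
  have hα := FibreBundle.Lagrangian.differentiableAt_deDonderForm hZ
  let φ := hL.diffeomorph hZ hΨ₀
  have hpt : ∀ q, (φ q).1.pt = q.1.pt := hΨ₀.pt_apply
  have hproj : ∀ q, L.projZ (φ q) = L.projN q := fun q => congrArg B.proj (hpt q)
  refine ⟨φ, hpt, fun Ψ hΨ => ?_⟩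
  -- $\varphi$ is built from one section $\Psi_0$. For any other $\Psi$, the jets $\Psi_0(q)$ and
  -- $\Psi(q)$ lie in the same fibre of $\widehat L$, on which $\widehat H_L$ is constant.
  have hφΨ : ∀ q, φ q = L.homLegendreZ (Ψ q) := fun q => Subtype.ext <|
    hL.homLegendre_eq ((hΨ₀.legendreN_apply q).trans (hΨ.legendreN_apply q).symm)
  have hform : L.constrainedForm EN Ψ = DiffForm.pullback φ (L.deDonderForm EZ) := by
    rw [FibreBundle.Lagrangian.constrainedForm_eq_pullback hZ hΨ]
    exact congrArg (fun f => DiffForm.pullback f (L.deDonderForm EZ)) (funext hφΨ).symm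
  refine ⟨hφΨ, hform, fun U hU => ⟨fun r hr => ?_, fun s hs => ?_⟩⟩
  · rw [hform]
    -- Openness of $U$ turns smoothness on $U$ into differentiability at each of its points, as the
    -- equations involve the unrestricted tangent map of $r$.
    exact solvesHamiltonEquations_pullback_iff φ hpN hpZ hproj hα fun x hx =>
      (hr.contMDiffOn.contMDiffAt (hU.mem_nhds hx)).mdifferentiableAt (by simp)
  · have hr : ∀ x ∈ U, MDifferentiableAt 𝓘(ℝ, BaseModel n) 𝓘(ℝ, EN) (φ.symm ∘ s) x :=
      fun x hx => (φ.symm.contMDiff.contMDiffAt.comp x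
        (hs.contMDiffOn.contMDiffAt (hU.mem_nhds hx))).mdifferentiableAt (by simp)
    -- The second equivalence is the first one for the section $\varphi^{-1}\circ s$.
    have h := solvesHamiltonEquations_pullback_iff φ hpN hpZ hproj hα hr
    have hs' : φ ∘ φ.symm ∘ s = s := funext fun x => φ.apply_symm_apply (s x)
    rw [hs', ← hform] at h
    exact h.symm
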